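/- Programs, outputs. A prefix machine with side information in $\mathbb N\times\mathbb N$ is a partial computable map $T:\{0,1\}^*\times\mathbb N^2\rightharpoonup\{0,1\}^*$ such that for every $y\in\mathbb N^2$ the set of programs $p$ for which $T(p,y)$ is defined is prefix-free; put $K_T(w\mid y)=\min\{\ell(p): T(p,y)=w\}$ ($=\infty$ if there is no such $p$). Let $U$ be an additively optimal prefix machine: for every prefix machine $T$ there is a constant $c_T$ with $K_U(w\mid y)\le K_T(w\mid y)+c_T$ for all $w,y$. For $\mathbf u\in\mathbb R^n$ let $K(\mathbf u\mid n,m)$ be the minimum of $K_U(w\mid (n,m))$ over all strings $w$ that are concatenations of $n$ blocks of a common length $l\ge 0$, the $i$-th block being a binary expansion $u_i=\sum_{j=1}^{l}2^{-j}b_{ij}$ of the $i$-th coordinate ($=\infty$ if $\mathbf u$ has no such finite expansion). The complexity of $\mathbf x\in\mathbb R^n$ at resolution $m$ is $$K^{[\cdot]_m}(\mathbf x)=\inf\{K(\mathbf u\mid n,m):\ \mathbf u\in[0,1]^n,\ \|\mathbf x-\mathbf u\|_\infty\le 2^{-m}\}.$$ Theorem. Let $d\ge 1$, $n,m\ge 0$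 be integers, $\kappa_{m,n},\epsilon_n\in\mathbb R$ and $0<t<1$. Let $D\subseteq\mathbb R^n$ be a closed set of admissible signals (for example $D=\mathbb R^n$ or $D=[0,1]^n$). Let $\mathbf x_o\in\mathbb R^n$ and suppose that there is $\tilde{\mathbf x}_o\in D$ with $\|\mathbf x_o-\tilde{\mathbf x}_o\|_2\le\epsilon_n$ and $K^{[\cdot]_m}(\tilde{\mathbf x}_o)\le\kappa_{m,n}m$. Let $A$ be a random $d\times n$ matrix with i.i.d. $\mathcal N(0,1)$ entries and let $\mathbf y=A\mathbf x_o$. Then the problem $$\min\ \|\mathbf y-A\mathbf x\|_2^2\quad\text{subject to}\quad \mathbf x\in D,\ K^{[\cdot]_m}(\mathbf x)\le\kappa_{m,n}m$$ always has a minimiser, and for every choice $\hat{\mathbf x}_o$ of a minimiser (as a function of the random outcome), $$\mathbb P\Big(\|\mathbf x_o-\hat{\mathbf x}_o\|_2>\tfrac1{\sqrt{1-t}}\Big(\sqrt{\tfrac nd}+2\Big)\big(2^{-m}\sqrt n+2\epsilon_n\big)+2^{-m}\sqrt n\Big)\le 2^{\kappa_{m,n}m}\,e^{\frac d2(t+\log(1-t))}+e^{-\frac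 d2},$$ where $\mathbb P$ is read as outer probability if the event is not measurable. -/

import Mathlib

open MeasureTheory ProbabilityTheory

/-- A machine reads a program (a binary string) and side information from `Y`, and either prints a
binary string and halts, or does not halt. -/
abbrev Machine (Y : Type) : Type := List Bool → Y → Part (List Bool)

/-- A prefix machine: a partial computable map such that, for every side information, no program on
which it halts is a proper prefix of another program on which it halts. -/
structure IsPrefixMachine {Y : Type} [Primcodable Y] (T : Machine Y) : Prop where
  partrec : Partrec₂ T
  prefix_free : ∀ (y : Y) (p q : List Bool),
    (T p y).Dom → (T q y).Dom → p <+: q → p = q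

/-- `K_T(w | y)`: the length of a shortest program that makes `T`, given `y`, print `w` and halt
(`⊤` if there is none). -/
noncomputable def condComplexity {Y : Type} (T : Machine Y) (w : List Bool) (y : Y) : ℕ∞ :=
  ⨅ (p : List Bool) (_ : w ∈ T p y), (p.length : ℕ∞)

/-- An additively optimal prefix machine (invariance property). -/
structure IsOptimalPrefixMachine {Y : Type} [Primcodable Y] (U : Machine Y) : Prop where
  isPrefixMachine : IsPrefixMachine U
  optimal : ∀ T : Machine Y, IsPrefixMachine T →
    ∃ c : ℕ, ∀ (w : List Bool) (y : Y), condComplexity U w y ≤ condComplexity T w y + c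

/-- The string `w` is the concatenation of `n` blocks of a common length `l`, and the `i`-th block
is a binary expansion (after the binary point) of the `i`-th coordinate of `u`. -/
def IsBinaryExpansion {n : ℕ} (w : List Bool) (u : EuclideanSpace ℝ (Fin n)) : Prop :=
  ∃ l : ℕ, w.length = n * l ∧
    ∀ i : Fin n, u i =
      ∑ j ∈ Finset.range l, if w.getD ((i : ℕ) * l + j) false then (2 : ℝ)⁻¹ ^ (j + 1) else 0

/-- `K(u | n, m)` for a real vector `u`: the length of a shortest program that, given `(n, m)`,
prints the (concatenated) binary expansions of the coordinates of `u` and halts. -/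
noncomputable def vectorComplexity (U : Machine (ℕ × ℕ)) (m : ℕ) {n : ℕ}
    (u : EuclideanSpace ℝ (Fin n)) : ℕ∞ :=
  ⨅ (w : List Bool) (_ : IsBinaryExpansion w u), condComplexity U w (n, m)

/-- The complexity of `x` at resolution `m`: the least `K(u | n, m)` over `u ∈ [0,1]^n` with
`‖x - u‖_∞ ≤ 2^{-m}`. -/
noncomputable def quantizedComplexity (U : Machine (ℕ × ℕ)) (m : ℕ) {n : ℕ}
    (x : EuclideanSpace ℝ (Fin n)) : ℕ∞ :=
  ⨅ (u : EuclideanSpace ℝ (Fin n)) (_ : ∀ i, u i ∈ Set.Icc (0 : ℝ) 1)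
    (_ : ∀ i, |x i - u i| ≤ (2 : ℝ)⁻¹ ^ m), vectorComplexity U m u

/-- `x` has complexity at resolution `m` at most `κ m`; both sides are compared as extended real
numbers. -/
def HasComplexityAtMost (U : Machine (ℕ × ℕ)) (m : ℕ) (κ : ℝ) {n : ℕ}
    (x : EuclideanSpace ℝ (Fin n)) : Prop :=
  (((quantizedComplexity U m x : ℕ∞) : ENNReal) : EReal) ≤ ((κ * m : ℝ) : EReal)

/-- `z` minimises `‖y - A x‖₂²` over the `x ∈ D` whose complexity at resolution `m` is at most
`κ m`. -/
structure IsLowComplexityLeastSquares (U : Machine (ℕ × ℕ)) (m : ℕ) (κ : ℝ) {d n : ℕ}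
    (D : Set (EuclideanSpace ℝ (Fin n))) (A : Matrix (Fin d) (Fin n) ℝ)
    (y : EuclideanSpace ℝ (Fin d)) (z : EuclideanSpace ℝ (Fin n)) : Prop where
  mem : z ∈ D
  feasible : HasComplexityAtMost U m κ z
  minimal : ∀ x ∈ D, HasComplexityAtMost U m κ x →
    ‖y - A.toEuclideanLin z‖ ^ 2 ≤ ‖y - A.toEuclideanLin x‖ ^ 2

/-- The entries of the random matrix `A` are i.i.d. standard Gaussian random variables. -/
structure IsStandardGaussianMatrix {Ω : Type*} [MeasurableSpace Ω] (P : Measure Ω) {d n : ℕ}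
    (A : Ω → Matrix (Fin d) (Fin n) ℝ) : Prop where
  law : ∀ i j, HasLaw (fun ω => A ω i j) (gaussianReal 0 1) P
  indep : iIndepFun (fun (ij : Fin d × Fin n) ω => A ω ij.1 ij.2) P

/-!
Every vector of complexity at most `κ m` lies within `2⁻ᵐ` (in the sup norm, hence within `2⁻ᵐ √n`
in the Euclidean norm) of a point `u` of a grid, namely the points of the unit cube with a program
of length at most `κ m`. Programs that halt on the side information `(n, m)` form a prefix-free set,
so the grid has at most `2 ^ (κ m)` points (`lowComplexityGrid_finite_and_ncard_le`). The feasible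
set is therefore a finite union of boxes intersected with the closed set `D`, hence compact, which
gives minimisers.

If `u` is the grid point of the minimiser `z`, comparison of `z` with the feasible point `xtilde`
bounds `‖A (xo - u)‖` by `‖A‖ (ε + 2⁻ᵐ √n)`. The recovery bound follows
(`norm_sub_le_of_isLowComplexityLeastSquares`) outside two kinds of events:

* `A` shrinks one of the fixed vectors `xo - u` too much. For each `u` this is a lower tail of a
  chi-squared variable (`measureReal_sum_mulVec_sq_lt_le`), and a union bound over the grid gives
  the first term of the estimate.
* `‖A‖ > √n + 2 √d`. This is the Davidson–Szarek bound with deviation `√d`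
  (`measure_exists_unit_lt_bilinear_le`), the second term.

The sharp constant in the norm bound comes from a comparison of exponential moments rather than
from a comparison of expectations followed by concentration. For unit vectors `v`, `w`, the process
`wᵀ A v + γ` with an independent standard Gaussian `γ` has the same variances as
`⟨g, v⟩ + ⟨h, w⟩` and larger covariances. Rotating one process into the other and integrating by
parts (`integral_dotProduct_mul_gaussianPi`) shows that the expectation of
`(∑ exp (β X_i)) ^ (s / β)`, a smooth version of `exp (s max X_i)`, is smaller for the first process
(`integral_partitionFn_rpow_le`). For the second process the maximum is at most `‖g‖ + ‖h‖`, whose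
exponential moment is bounded by chi-squared moments; the factor `exp (s² / 2)` contributed by `γ`
cancels the excess, and `β → ∞` removes the dependence on the number of pairs.
-/

/-! ### Gaussian measure on a finite power of the line: density, integration by parts, blocks -/

/-- The law of a family of i.i.d. standard Gaussian variables indexed by `K`. -/
noncomputable abbrev gaussianPi (K : Type*) [Fintype K] : Measure (K → ℝ) :=
  Measure.pi fun _ => gaussianReal 0 1

theorem gaussianPi_eq_withDensity (K : Type*) [Fintype K] :
    gaussianPi K = (volume : Measure (K → ℝ)).withDensity
      (fun x => ENNReal.ofReal (∏ k, gaussianPDFReal 0 1 (x k))) := by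
  refine Measure.pi_eq fun s hs => ?_
  rw [withDensity_apply _ (MeasurableSet.univ_pi hs), volume_pi, Measure.restrict_pi_pi,
    ← ofReal_integral_eq_lintegral_ofReal]
  · rw [integral_fintype_prod_eq_prod (f := fun _ => gaussianPDFReal 0 1),
      ENNReal.ofReal_prod_of_nonneg]
    · exact Finset.prod_congr rfl fun k _ => (gaussianReal_apply_eq_integral 0 one_ne_zero _).symm
    · exact fun k _ => integral_nonneg fun x => gaussianPDFReal_nonneg _ _ _
  · exact Integrable.fintype_prod fun k => (integrable_gaussianPDFReal 0 1).restrict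
  · exact ae_of_all _ fun x => Finset.prod_nonneg fun k _ => gaussianPDFReal_nonneg _ _ _

theorem integrable_gaussianPi_iff {K : Type*} [Fintype K] {f : (K → ℝ) → ℝ} :
    Integrable f (gaussianPi K) ↔
      Integrable (fun x => f x * ∏ k, gaussianPDFReal 0 1 (x k)) := by
  rw [gaussianPi_eq_withDensity, integrable_withDensity_iff]
  · refine integrable_congr (ae_of_all _ fun x => ?_)
    simp only
    rw [ENNReal.toReal_ofReal (Finset.prod_nonneg fun k _ => gaussianPDFReal_nonneg _ _ _)]
  · fun_prop
  · exact ae_of_all _ fun x => ENNReal.ofReal_lt_top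

theorem integral_gaussianPi {K : Type*} [Fintype K] (f : (K → ℝ) → ℝ) :
    ∫ x, f x ∂gaussianPi K = ∫ x, f x * ∏ k, gaussianPDFReal 0 1 (x k) := by
  rw [gaussianPi_eq_withDensity, integral_withDensity_eq_integral_toReal_smul (by fun_prop)
    (ae_of_all _ fun x => ENNReal.ofReal_lt_top)]
  refine integral_congr_ae (ae_of_all _ fun x => ?_)
  simp only [smul_eq_mul]
  rw [ENNReal.toReal_ofReal (Finset.prod_nonneg fun k _ => gaussianPDFReal_nonneg _ _ _), mul_comm]

theorem hasLineDerivAt_prod_gaussianPDFReal {K : Type*} [Fintype K] (x v : K → ℝ) :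
    HasLineDerivAt ℝ (fun x : K → ℝ => ∏ k, gaussianPDFReal 0 1 (x k))
      (-(v ⬝ᵥ x) * ∏ k, gaussianPDFReal 0 1 (x k)) x v := by
  have key : ∀ y : K → ℝ, ∏ k, gaussianPDFReal 0 1 (y k)
      = (∏ _k : K, (√(2 * Real.pi))⁻¹) * Real.exp (-(∑ k, y k ^ 2) / 2) := by
    intro y
    simp only [gaussianPDFReal, NNReal.coe_one, mul_one, sub_zero]
    rw [Finset.prod_mul_distrib, ← Real.exp_sum, neg_div, Finset.sum_div, ← Finset.sum_neg_distrib]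
    simp only [neg_div]
  simp only [key]
  unfold HasLineDerivAt
  have h1 : HasDerivAt (fun s : ℝ => ∑ k, (x + s • v) k ^ 2) (∑ k, 2 * x k * v k) 0 := by
    refine HasDerivAt.fun_sum fun k _ => ?_
    have : HasDerivAt (fun s : ℝ => (x k + s * v k)) (v k) 0 := by
      simpa using ((hasDerivAt_id (0 : ℝ)).mul_const (v k)).const_add (x k)
    simpa using this.fun_pow 2
  have h2 := ((h1.neg.div_const 2).exp).const_mul (∏ _k : K, (√(2 * Real.pi))⁻¹)
  convert! h2 using 1
  have : ∑ k, 2 * x k * v k = 2 * (v ⬝ᵥ x) := by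
    rw [dotProduct, Finset.mul_sum]; exact Finset.sum_congr rfl fun k _ => by ring
  rw [this]
  simp
  ring

/-- Gaussian integration by parts (Stein's identity) in direction `v`. -/
theorem integral_dotProduct_mul_gaussianPi {K : Type*} [Fintype K] (v : K → ℝ)
    {F F' : (K → ℝ) → ℝ} (hF : ∀ x, HasLineDerivAt ℝ F (F' x) x v)
    (h0 : Integrable F (gaussianPi K)) (h1 : Integrable F' (gaussianPi K))
    (h2 : Integrable (fun x => (v ⬝ᵥ x) * F x) (gaussianPi K)) :
    ∫ x, (v ⬝ᵥ x) * F x ∂gaussianPi K = ∫ x, F' x ∂gaussianPi K := by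
  rw [integrable_gaussianPi_iff] at h0 h1 h2
  have key := integral_bilinear_hasLineDerivAt_right_eq_neg_left_of_integrable
    (μ := (volume : Measure (K → ℝ))) (B := ContinuousLinearMap.mul ℝ ℝ)
    (f := F) (f' := F') (g := fun x : K → ℝ => ∏ k, gaussianPDFReal 0 1 (x k))
    (g' := fun x => -(v ⬝ᵥ x) * ∏ k, gaussianPDFReal 0 1 (x k)) (v := v)
    (by simpa using h1)
    (by
      refine h2.neg.congr (ae_of_all _ fun x => ?_)
      simp only [Pi.neg_apply, ContinuousLinearMap.mul_apply']
      ring)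
    (by simpa using h0) (fun x _ => hF x)
    (fun x _ => hasLineDerivAt_prod_gaussianPDFReal x v)
  simp only [ContinuousLinearMap.mul_apply'] at key
  rw [integral_gaussianPi, integral_gaussianPi]
  rw [← neg_inj, ← key, ← integral_neg]
  congr 1
  ext x
  ring

theorem integrable_exp_mul_abs_gaussianReal (B : ℝ) :
    Integrable (fun x => Real.exp (B * |x|)) (gaussianReal 0 1) := by
  refine ((integrable_exp_mul_gaussianReal (μ := 0) (v := 1) B).add
    (integrable_exp_mul_gaussianReal (μ := 0) (v := 1) (-B))).mono' (by fun_prop)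
    (ae_of_all _ fun x => ?_)
  rw [Real.norm_eq_abs, Real.abs_exp, Pi.add_apply]
  rcases abs_cases x with ⟨h, _⟩ | ⟨h, _⟩ <;> rw [h]
  · have := Real.exp_pos (-B * x); linarith
  · have := Real.exp_pos (B * x); rw [show B * -x = -B * x by ring]; linarith

theorem integrable_exp_sum_abs_gaussianPi {K : Type*} [Fintype K] (B : ℝ) :
    Integrable (fun x : K → ℝ => Real.exp (B * ∑ k, |x k|)) (gaussianPi K) := by
  simp only [Finset.mul_sum, Real.exp_sum]
  exact Integrable.fintype_prod fun _ => integrable_exp_mul_abs_gaussianReal B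

/-- `E exp (s g² / 2) = (1 - s)^(-1/2)` for a standard Gaussian variable `g`. The case of interest is
`s < 1`; otherwise the integral diverges and both sides are the default value `0`. -/
theorem integral_exp_mul_sq_gaussianReal (s : ℝ) :
    ∫ x, Real.exp (s * x ^ 2 / 2) ∂gaussianReal 0 1 = (√(1 - s))⁻¹ := by
  rw [integral_gaussianReal_eq_integral_smul one_ne_zero]
  have : ∀ x : ℝ, gaussianPDFReal 0 1 x • Real.exp (s * x ^ 2 / 2)
      = (√(2 * Real.pi))⁻¹ * Real.exp (-((1 - s) / 2) * x ^ 2) := by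
    intro x
    simp only [gaussianPDFReal, NNReal.coe_one, mul_one, sub_zero, smul_eq_mul]
    rw [mul_assoc, ← Real.exp_add]
    ring_nf
  simp only [this]
  rw [integral_const_mul, integral_gaussian]
  rw [show Real.pi / ((1 - s) / 2) = (2 * Real.pi) / (1 - s) by field_simp,
    Real.sqrt_div (by positivity)]
  have : 0 < √(2 * Real.pi) := by positivity
  field_simp

theorem integrable_exp_mul_sq_gaussianReal {s : ℝ} (hs : s < 1) :
    Integrable (fun x => Real.exp (s * x ^ 2 / 2)) (gaussianReal 0 1) := by
  by_contra h
  have h1 := integral_exp_mul_sq_gaussianReal s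
  rw [integral_undef h] at h1
  have : 0 < (√(1 - s))⁻¹ := inv_pos.2 (Real.sqrt_pos.2 (by linarith))
  linarith

/-- Independent blocks: the Gaussian measure on a disjoint union of index types is a product. -/
theorem map_sumElim_gaussianPi_prod (K L : Type*) [Fintype K] [Fintype L] :
    ((gaussianPi K).prod (gaussianPi L)).map (fun p => Sum.elim p.1 p.2) = gaussianPi (K ⊕ L) := by
  have hm : Measurable fun p : (K → ℝ) × (L → ℝ) => (Sum.elim p.1 p.2 : K ⊕ L → ℝ) := by
    rw [measurable_pi_iff]
    rintro (k | l) <;> simp only [Sum.elim_inl, Sum.elim_inr] <;> fun_prop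
  refine (Measure.pi_eq fun s hs => ?_).symm
  rw [Measure.map_apply hm (MeasurableSet.univ_pi hs)]
  have : (fun p : (K → ℝ) × (L → ℝ) => (Sum.elim p.1 p.2 : K ⊕ L → ℝ)) ⁻¹' (Set.univ.pi s)
      = (Set.univ.pi fun k => s (Sum.inl k)) ×ˢ (Set.univ.pi fun l => s (Sum.inr l)) := by
    ext p; simp [Set.mem_pi]
  rw [this, Measure.prod_prod, Measure.pi_pi, Measure.pi_pi, Fintype.prod_sum_type]

theorem integral_gaussianPi_sum_mul {K L : Type*} [Fintype K] [Fintype L]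
    (f : (K → ℝ) → ℝ) (g : (L → ℝ) → ℝ) (hf : Measurable f) (hg : Measurable g) :
    ∫ x, f (fun k => x (Sum.inl k)) * g (fun l => x (Sum.inr l)) ∂gaussianPi (K ⊕ L)
      = (∫ x, f x ∂gaussianPi K) * ∫ y, g y ∂gaussianPi L := by
  have hm : Measurable fun p : (K → ℝ) × (L → ℝ) => (Sum.elim p.1 p.2 : K ⊕ L → ℝ) := by
    rw [measurable_pi_iff]
    rintro (k | l) <;> simp only [Sum.elim_inl, Sum.elim_inr] <;> fun_prop
  rw [← map_sumElim_gaussianPi_prod, integral_map hm.aemeasurable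
    (by refine Measurable.aestronglyMeasurable ?_; fun_prop)]
  simp only [Sum.elim_inl, Sum.elim_inr]
  exact integral_prod_mul f g

/-! ### Comparison of soft maxima of Gaussian processes -/

theorem integrable_gaussianPi_of_le_exp {K : Type*} [Fintype K] {h : (K → ℝ) → ℝ}
    (hm : Measurable h) (C B : ℝ) (hb : ∀ x, |h x| ≤ C * Real.exp (B * ∑ k, |x k|)) :
    Integrable h (gaussianPi K) :=
  ((integrable_exp_sum_abs_gaussianPi B).const_mul C).mono' hm.aestronglyMeasurable
    (ae_of_all _ fun x => by simpa using hb x)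

theorem abs_dotProduct_le_mul_sum_abs {K : Type*} [Fintype K] {R : ℝ} {v : K → ℝ}
    (hv : ∀ k, |v k| ≤ R) (x : K → ℝ) : |v ⬝ᵥ x| ≤ R * ∑ k, |x k| := by
  rw [dotProduct, Finset.mul_sum]
  refine (Finset.abs_sum_le_sum_abs _ _).trans (Finset.sum_le_sum fun k _ => ?_)
  rw [abs_mul]
  exact mul_le_mul_of_nonneg_right (hv k) (abs_nonneg _)

/-- The partition function `∑ i, exp (β ⟨c i, x⟩)` of a family of linear forms; its powers are
smooth substitutes for `exp (λ * max i, ⟨c i, x⟩)`. -/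
noncomputable def partitionFn {T K : Type*} [Fintype T] [Fintype K] (β : ℝ) (c : T → K → ℝ)
    (x : K → ℝ) : ℝ :=
  ∑ i, Real.exp (β * (c i ⬝ᵥ x))

section PartitionFn

variable {T K : Type*} [Fintype T] [Fintype K]

@[fun_prop]
theorem measurable_partitionFn (β : ℝ) (c : T → K → ℝ) : Measurable (partitionFn β c) := by
  unfold partitionFn dotProduct
  fun_prop

theorem exp_le_partitionFn (β : ℝ) (c : T → K → ℝ) (x : K → ℝ) (i : T) :
    Real.exp (β * (c i ⬝ᵥ x)) ≤ partitionFn β c x :=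
  Finset.single_le_sum (f := fun i => Real.exp (β * (c i ⬝ᵥ x)))
    (fun _ _ => (Real.exp_pos _).le) (Finset.mem_univ i)

theorem partitionFn_pos [Nonempty T] (β : ℝ) (c : T → K → ℝ) (x : K → ℝ) :
    0 < partitionFn β c x :=
  (Real.exp_pos _).trans_le (exp_le_partitionFn β c x (Classical.arbitrary T))

theorem partitionFn_rpow_le [Nonempty T] {β R r : ℝ} (hβ : 0 ≤ β) (hr0 : 0 ≤ r) (hr1 : r ≤ 1)
    {c : T → K → ℝ} (hc : ∀ i k, |c i k| ≤ R) (x : K → ℝ) :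
    partitionFn β c x ^ r ≤ Fintype.card T * Real.exp (β * R * ∑ k, |x k|) := by
  have hR : 0 ≤ R * ∑ k, |x k| :=
    (abs_nonneg _).trans (abs_dotProduct_le_mul_sum_abs (hc (Classical.arbitrary T)) x)
  have h1 : partitionFn β c x ≤ Fintype.card T * Real.exp (β * R * ∑ k, |x k|) := by
    unfold partitionFn
    refine (Finset.sum_le_card_nsmul _ _ (Real.exp (β * R * ∑ k, |x k|)) fun i _ => ?_).trans ?_
    · rw [mul_assoc]
      exact Real.exp_le_exp.2 (mul_le_mul_of_nonneg_left
        ((le_abs_self _).trans (abs_dotProduct_le_mul_sum_abs (hc i) x)) hβ)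
    · simp
  have h2 : (1 : ℝ) ≤ Fintype.card T * Real.exp (β * R * ∑ k, |x k|) := by
    have : (1 : ℝ) ≤ Fintype.card T := by exact_mod_cast Fintype.card_pos
    refine one_le_mul_of_one_le_of_one_le this (Real.one_le_exp ?_)
    rw [mul_assoc]; positivity
  calc partitionFn β c x ^ r ≤ (Fintype.card T * Real.exp (β * R * ∑ k, |x k|)) ^ r :=
        Real.rpow_le_rpow (partitionFn_pos β c x).le h1 hr0
    _ ≤ _ := by simpa using Real.rpow_le_rpow_of_exponent_le h2 hr1

/-- One factor `exp (β ⟨c i, x⟩)` costs one power of the partition function. -/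
theorem partitionFn_rpow_sub_one_mul_exp_le [Nonempty T] (β r : ℝ) (c : T → K → ℝ) (x : K → ℝ)
    (i : T) :
    partitionFn β c x ^ (r - 1) * Real.exp (β * (c i ⬝ᵥ x)) ≤ partitionFn β c x ^ r := by
  have hS := partitionFn_pos β c x
  calc _ ≤ partitionFn β c x ^ (r - 1) * partitionFn β c x :=
        mul_le_mul_of_nonneg_left (exp_le_partitionFn β c x i) (Real.rpow_nonneg hS.le _)
    _ = _ := by
        rw [Real.rpow_sub_one hS.ne']
        field_simp

theorem hasLineDerivAt_partitionFn (β : ℝ) (c : T → K → ℝ) (x v : K → ℝ) :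
    HasLineDerivAt ℝ (partitionFn β c)
      (∑ j, β * (c j ⬝ᵥ v) * Real.exp (β * (c j ⬝ᵥ x))) x v := by
  unfold HasLineDerivAt partitionFn
  refine HasDerivAt.fun_sum fun j _ => ?_
  have h : HasDerivAt (fun s : ℝ => β * (c j ⬝ᵥ (x + s • v))) (β * (c j ⬝ᵥ v)) 0 := by
    simp only [dotProduct_add, dotProduct_smul, smul_eq_mul]
    simpa using (((hasDerivAt_id (0 : ℝ)).mul_const (c j ⬝ᵥ v)).const_add (c j ⬝ᵥ x)).const_mul β
  have h2 := h.exp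
  simp only [zero_smul, add_zero] at h2
  convert! h2 using 1
  ring

theorem hasLineDerivAt_exp_mul_partitionFn_rpow [Nonempty T] (β r : ℝ) (c : T → K → ℝ)
    (x v : K → ℝ) (i : T) :
    HasLineDerivAt ℝ (fun x => partitionFn β c x ^ (r - 1) * Real.exp (β * (c i ⬝ᵥ x)))
      (β * (c i ⬝ᵥ v) * (partitionFn β c x ^ (r - 1) * Real.exp (β * (c i ⬝ᵥ x)))
        + ∑ j, (r - 1) * β * (c j ⬝ᵥ v) * (partitionFn β c x ^ (r - 1 - 1)
          * Real.exp (β * (c j ⬝ᵥ x)) * Real.exp (β * (c i ⬝ᵥ x)))) x v := by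
  have h1 := hasLineDerivAt_partitionFn β c x v
  unfold HasLineDerivAt at h1 ⊢
  have h : HasDerivAt (fun s : ℝ => β * (c i ⬝ᵥ (x + s • v))) (β * (c i ⬝ᵥ v)) 0 := by
    simp only [dotProduct_add, dotProduct_smul, smul_eq_mul]
    simpa using (((hasDerivAt_id (0 : ℝ)).mul_const (c i ⬝ᵥ v)).const_add (c i ⬝ᵥ x)).const_mul β
  have h2 := h1.rpow_const (p := r - 1) (Or.inl (by
    simpa using (partitionFn_pos β c x).ne'))
  have h3 := h2.mul h.exp
  simp only [zero_smul, add_zero] at h3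
  convert! h3 using 1
  rw [add_comm]
  congr 1
  · rw [Finset.sum_mul, Finset.sum_mul, Finset.sum_mul]
    exact Finset.sum_congr rfl fun j _ => by ring
  · ring

/-- Gaussian integration by parts applied to the Gibbs weights of the partition function. -/
theorem integral_partitionFn_stein [Nonempty T] {β R r : ℝ} (hβ : 0 ≤ β) (hr0 : 0 ≤ r)
    (hr1 : r ≤ 1) {c v : T → K → ℝ} (hc : ∀ i k, |c i k| ≤ R) (hv : ∀ i k, |v i k| ≤ R) (i : T) :
    ∫ x, (v i ⬝ᵥ x) * (partitionFn β c x ^ (r - 1) * Real.exp (β * (c i ⬝ᵥ x))) ∂gaussianPi K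
      = ∫ x, (β * (c i ⬝ᵥ v i) * (partitionFn β c x ^ (r - 1) * Real.exp (β * (c i ⬝ᵥ x)))
        + ∑ j, (r - 1) * β * (c j ⬝ᵥ v i) * (partitionFn β c x ^ (r - 1 - 1)
          * Real.exp (β * (c j ⬝ᵥ x)) * Real.exp (β * (c i ⬝ᵥ x)))) ∂gaussianPi K ∧
    Integrable (fun x => β * (c i ⬝ᵥ v i) *
        (partitionFn β c x ^ (r - 1) * Real.exp (β * (c i ⬝ᵥ x)))
        + ∑ j, (r - 1) * β * (c j ⬝ᵥ v i) * (partitionFn β c x ^ (r - 1 - 1)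
          * Real.exp (β * (c j ⬝ᵥ x)) * Real.exp (β * (c i ⬝ᵥ x)))) (gaussianPi K) ∧
    Integrable (fun x => (v i ⬝ᵥ x) *
      (partitionFn β c x ^ (r - 1) * Real.exp (β * (c i ⬝ᵥ x)))) (gaussianPi K) := by
  have hdot : ∀ w : K → ℝ, Measurable fun x : K → ℝ => w ⬝ᵥ x := by
    intro w; unfold dotProduct; fun_prop
  have hb1 : ∀ x, |partitionFn β c x ^ (r - 1) * Real.exp (β * (c i ⬝ᵥ x))|
      ≤ Fintype.card T * Real.exp (β * R * ∑ k, |x k|) := fun x => by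
    have := partitionFn_pos β c x
    rw [abs_of_nonneg (by positivity)]
    exact (partitionFn_rpow_sub_one_mul_exp_le β r c x i).trans
      (partitionFn_rpow_le hβ hr0 hr1 hc x)
  have hb2 : ∀ j x, |partitionFn β c x ^ (r - 1 - 1) * Real.exp (β * (c j ⬝ᵥ x))
      * Real.exp (β * (c i ⬝ᵥ x))| ≤ Fintype.card T * Real.exp (β * R * ∑ k, |x k|) :=
    fun j x => by
      have := partitionFn_pos β c x
      rw [abs_of_nonneg (by positivity)]
      refine (mul_le_mul_of_nonneg_right (partitionFn_rpow_sub_one_mul_exp_le β (r - 1) c x j)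
        (Real.exp_pos _).le).trans ?_
      exact (le_abs_self _).trans (hb1 x)
  have hi1 : Integrable (fun x => partitionFn β c x ^ (r - 1) * Real.exp (β * (c i ⬝ᵥ x)))
      (gaussianPi K) :=
    integrable_gaussianPi_of_le_exp (by fun_prop) _ _ hb1
  have hi2 : Integrable (fun x => β * (c i ⬝ᵥ v i) *
        (partitionFn β c x ^ (r - 1) * Real.exp (β * (c i ⬝ᵥ x)))
        + ∑ j, (r - 1) * β * (c j ⬝ᵥ v i) * (partitionFn β c x ^ (r - 1 - 1)
          * Real.exp (β * (c j ⬝ᵥ x)) * Real.exp (β * (c i ⬝ᵥ x)))) (gaussianPi K) :=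
    (hi1.const_mul _).add (integrable_finsetSum _ fun j _ =>
      (integrable_gaussianPi_of_le_exp (by fun_prop) _ _ (hb2 j)).const_mul _)
  have hi3 : Integrable (fun x => (v i ⬝ᵥ x) *
      (partitionFn β c x ^ (r - 1) * Real.exp (β * (c i ⬝ᵥ x)))) (gaussianPi K) := by
    refine integrable_gaussianPi_of_le_exp (by fun_prop) (Fintype.card T) (R + β * R) fun x => ?_
    rw [abs_mul, add_mul, Real.exp_add, mul_left_comm]
    refine mul_le_mul ?_ (hb1 x) (abs_nonneg _) (Real.exp_pos _).le
    have := abs_dotProduct_le_mul_sum_abs (hv i) x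
    linarith [Real.add_one_le_exp (R * ∑ k, |x k|)]
  exact ⟨integral_dotProduct_mul_gaussianPi (v i)
    (fun x => hasLineDerivAt_exp_mul_partitionFn_rpow β r c x (v i) i) hi1 hi2 hi3, hi2, hi3⟩

/-- Derivative of the expected power of the partition function along a bounded path of the
coefficient vectors, before integrating by parts. -/
theorem hasDerivAt_integral_partitionFn_rpow [Nonempty T] {β R r : ℝ} (hβ : 0 ≤ β) (hr0 : 0 ≤ r)
    (hr1 : r ≤ 1) {c c' : ℝ → T → K → ℝ} (hc : ∀ θ i k, |c θ i k| ≤ R)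
    (hc' : ∀ θ i k, |c' θ i k| ≤ R) (hd : ∀ θ i k, HasDerivAt (fun θ => c θ i k) (c' θ i k) θ)
    (θ : ℝ) :
    HasDerivAt (fun θ => ∫ x, partitionFn β (c θ) x ^ r ∂gaussianPi K)
      (∫ x, ∑ i, r * β * ((c' θ i ⬝ᵥ x) *
        (partitionFn β (c θ) x ^ (r - 1) * Real.exp (β * (c θ i ⬝ᵥ x)))) ∂gaussianPi K) θ := by
  have hdot : ∀ w : K → ℝ, Measurable fun x : K → ℝ => w ⬝ᵥ x := by
    intro w; unfold dotProduct; fun_prop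
  refine (hasDerivAt_integral_of_dominated_loc_of_deriv_le (s := Set.univ) (x₀ := θ)
    (F := fun θ x => partitionFn β (c θ) x ^ r)
    (F' := fun θ x => ∑ i, r * β * ((c' θ i ⬝ᵥ x) *
        (partitionFn β (c θ) x ^ (r - 1) * Real.exp (β * (c θ i ⬝ᵥ x)))))
    (bound := fun x => ∑ _i : T, r * β * (Fintype.card T *
      Real.exp ((R + β * R) * ∑ k, |x k|))) Filter.univ_mem ?_ ?_ ?_ ?_ ?_ ?_).2
  · exact Filter.Eventually.of_forall fun θ => by
      refine Measurable.aestronglyMeasurable ?_; fun_prop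
  · refine integrable_gaussianPi_of_le_exp (by fun_prop) (Fintype.card T) (β * R) fun x => ?_
    rw [abs_of_nonneg (Real.rpow_nonneg (partitionFn_pos _ _ _).le _)]
    exact partitionFn_rpow_le hβ hr0 hr1 (hc θ) x
  · refine Measurable.aestronglyMeasurable ?_; fun_prop
  · refine ae_of_all _ fun x θ _ => ?_
    rw [Real.norm_eq_abs]
    refine (Finset.abs_sum_le_sum_abs _ _).trans (Finset.sum_le_sum fun i _ => ?_)
    rw [abs_mul, abs_of_nonneg (mul_nonneg hr0 hβ)]
    refine mul_le_mul_of_nonneg_left ?_ (mul_nonneg hr0 hβ)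
    have hS := partitionFn_pos β (c θ) x
    have hb1 : |partitionFn β (c θ) x ^ (r - 1) * Real.exp (β * (c θ i ⬝ᵥ x))|
        ≤ Fintype.card T * Real.exp (β * R * ∑ k, |x k|) := by
      rw [abs_of_nonneg (by positivity)]
      exact (partitionFn_rpow_sub_one_mul_exp_le β r (c θ) x i).trans
        (partitionFn_rpow_le hβ hr0 hr1 (hc θ) x)
    rw [abs_mul, add_mul, Real.exp_add, mul_left_comm]
    refine mul_le_mul ?_ hb1 (abs_nonneg _) (Real.exp_pos _).le
    have := abs_dotProduct_le_mul_sum_abs (hc' θ i) x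
    linarith [Real.add_one_le_exp (R * ∑ k, |x k|)]
  · exact integrable_finsetSum _ fun _ _ =>
      ((integrable_exp_sum_abs_gaussianPi _).const_mul _).const_mul _
  · refine ae_of_all _ fun x θ _ => ?_
    have h1 : HasDerivAt (fun θ => partitionFn β (c θ) x)
        (∑ i, β * (c' θ i ⬝ᵥ x) * Real.exp (β * (c θ i ⬝ᵥ x))) θ := by
      unfold partitionFn
      refine HasDerivAt.fun_sum fun i _ => ?_
      have h : HasDerivAt (fun θ => c θ i ⬝ᵥ x) (c' θ i ⬝ᵥ x) θ := by
        unfold dotProduct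
        exact HasDerivAt.fun_sum fun k _ => (hd θ i k).mul_const _
      convert! (h.const_mul β).exp using 1
      ring
    have h2 := h1.rpow_const (p := r) (Or.inl (partitionFn_pos β (c θ) x).ne')
    convert! h2 using 1
    rw [Finset.sum_mul, Finset.sum_mul]
    exact Finset.sum_congr rfl fun i _ => by ring

/-- **Gaussian comparison** (Slepian–Gordon). If the linear forms `a i` and `b i` of a standard
Gaussian vector have equal variances and the covariances of `a` dominate those of `b`, then the
expected soft maximum of `a` is at most that of `b`. The two families are assumed orthogonal,
i.e. independent, so that rotating `a` into `b` preserves variances. -/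
theorem integral_partitionFn_rpow_le [Nonempty T] {β r : ℝ} (hβ : 0 ≤ β) (hr0 : 0 ≤ r)
    (hr1 : r ≤ 1) (a b : T → K → ℝ) (hab : ∀ i j, a i ⬝ᵥ b j = 0)
    (hdiag : ∀ i, a i ⬝ᵥ a i = b i ⬝ᵥ b i) (hcov : ∀ i j, b i ⬝ᵥ b j ≤ a i ⬝ᵥ a j) :
    ∫ x, partitionFn β a x ^ r ∂gaussianPi K ≤ ∫ x, partitionFn β b x ^ r ∂gaussianPi K := by
  set c : ℝ → T → K → ℝ := fun θ i => Real.cos θ • a i + Real.sin θ • b i with hcdef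
  set c' : ℝ → T → K → ℝ := fun θ i => -Real.sin θ • a i + Real.cos θ • b i with hcdef'
  set R : ℝ := ∑ i, ∑ k, (|a i k| + |b i k|) with hR
  have hle : ∀ i k, |a i k| + |b i k| ≤ R := fun i k =>
    (Finset.single_le_sum (f := fun k => |a i k| + |b i k|) (fun _ _ => by positivity)
      (Finset.mem_univ k)).trans
    (Finset.single_le_sum (f := fun i => ∑ k, (|a i k| + |b i k|))
      (fun _ _ => Finset.sum_nonneg fun _ _ => by positivity) (Finset.mem_univ i))
  have hcomb : ∀ (s t : ℝ), |s| ≤ 1 → |t| ≤ 1 → ∀ i k, |s * a i k + t * b i k| ≤ R := by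
    intro s t hs ht i k
    refine (abs_add_le _ _).trans (le_trans ?_ (hle i k))
    rw [abs_mul, abs_mul]
    exact add_le_add (mul_le_of_le_one_left (abs_nonneg _) hs)
      (mul_le_of_le_one_left (abs_nonneg _) ht)
  have hc : ∀ θ i k, |c θ i k| ≤ R := fun θ i k =>
    hcomb _ _ (Real.abs_cos_le_one θ) (Real.abs_sin_le_one θ) i k
  have hc' : ∀ θ i k, |c' θ i k| ≤ R := fun θ i k =>
    hcomb _ _ (by rw [abs_neg]; exact Real.abs_sin_le_one θ) (Real.abs_cos_le_one θ) i k
  have hd : ∀ θ i k, HasDerivAt (fun θ => c θ i k) (c' θ i k) θ := fun θ i k => by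
    simpa [hcdef, hcdef'] using
      ((Real.hasDerivAt_cos θ).mul_const (a i k)).fun_add ((Real.hasDerivAt_sin θ).mul_const (b i k))
  have hderiv := hasDerivAt_integral_partitionFn_rpow hβ hr0 hr1 hc hc' hd
  have hinner : ∀ θ i j, c θ j ⬝ᵥ c' θ i
      = Real.sin θ * Real.cos θ * (b j ⬝ᵥ b i - a j ⬝ᵥ a i) := by
    intro θ i j
    have hba : b j ⬝ᵥ a i = 0 := by rw [dotProduct_comm]; exact hab i j
    simp only [hcdef, hcdef', add_dotProduct, dotProduct_add, smul_dotProduct, dotProduct_smul,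
      smul_eq_mul, hab, hba]
    ring
  have hmono : MonotoneOn (fun θ => ∫ x, partitionFn β (c θ) x ^ r ∂gaussianPi K)
      (Set.Icc 0 (Real.pi / 2)) := by
    refine monotoneOn_of_deriv_nonneg (convex_Icc _ _)
      (fun θ _ => (hderiv θ).continuousAt.continuousWithinAt)
      (fun θ _ => (hderiv θ).differentiableAt.differentiableWithinAt) fun θ hθ => ?_
    rw [interior_Icc] at hθ
    have hs : 0 ≤ Real.sin θ :=
      Real.sin_nonneg_of_nonneg_of_le_pi hθ.1.le (by linarith [hθ.2, Real.pi_pos])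
    have hco : 0 ≤ Real.cos θ :=
      Real.cos_nonneg_of_neg_pi_div_two_le_of_le (by linarith [hθ.1, Real.pi_pos]) hθ.2.le
    rw [(hderiv θ).deriv, integral_finsetSum _ fun i _ =>
      ((integral_partitionFn_stein hβ hr0 hr1 (hc θ) (hc' θ) i).2.2).const_mul _]
    refine Finset.sum_nonneg fun i _ => ?_
    rw [integral_const_mul, (integral_partitionFn_stein hβ hr0 hr1 (hc θ) (hc' θ) i).1]
    refine mul_nonneg (mul_nonneg hr0 hβ) (integral_nonneg fun x => ?_)
    have hS := partitionFn_pos β (c θ) x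
    rw [hinner θ i i, hdiag i, sub_self, mul_zero, mul_zero, zero_mul, zero_add]
    refine Finset.sum_nonneg fun j _ => mul_nonneg ?_ (by positivity)
    rw [hinner θ i j]
    have h1 : 0 ≤ Real.sin θ * Real.cos θ * (a j ⬝ᵥ a i - b j ⬝ᵥ b i) :=
      mul_nonneg (mul_nonneg hs hco) (sub_nonneg.2 (hcov j i))
    nlinarith [mul_nonneg (mul_nonneg (sub_nonneg.2 hr1) hβ) h1]
  have hfin := hmono (Set.left_mem_Icc.2 (by positivity)) (Set.right_mem_Icc.2 (by positivity))
    (by positivity : (0 : ℝ) ≤ Real.pi / 2)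
  simpa [hcdef] using hfin

end PartitionFn

/-! ### The largest singular value of a Gaussian matrix -/

/-- The moment bound `E exp (s ‖g‖) ≤ exp (s √N + s² / 2)`, in the form that results from
`‖g‖ ≤ (‖g‖² / a + a) / 2` with `a = s + √N`. -/
theorem inv_sqrt_one_sub_div_pow_le {s : ℝ} (hs : 0 ≤ s) {N : ℕ} (hN : 0 < N) :
    (√(1 - s / (s + √N)))⁻¹ ^ N ≤ Real.exp (s * √N / 2) := by
  have hN' : 0 < √(N : ℝ) := Real.sqrt_pos.2 (by exact_mod_cast hN)
  have h1 : (1 - s / (s + √N))⁻¹ = s / √N + 1 := by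
    have h : s + √(N : ℝ) ≠ 0 := by positivity
    rw [one_sub_div h, add_sub_cancel_left, inv_div, add_div, div_self hN'.ne']
  have h2 : (√(1 - s / (s + √N)))⁻¹ ≤ Real.exp (s / √N / 2) := by
    rw [← Real.sqrt_inv, h1, Real.exp_half]
    exact Real.sqrt_le_sqrt (Real.add_one_le_exp _)
  refine (pow_le_pow_left₀ (by positivity) h2 N).trans (le_of_eq ?_)
  rw [← Real.exp_nat_mul]
  congr 1
  have : (N : ℝ) = √N * √N := (Real.mul_self_sqrt (by positivity)).symm
  nth_rewrite 1 [this]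
  field_simp

theorem dotProduct_le_one_of_unit {J : Type*} [Fintype J] {v w : J → ℝ} (hv : v ⬝ᵥ v = 1)
    (hw : w ⬝ᵥ w = 1) : v ⬝ᵥ w ≤ 1 := by
  have h : 0 ≤ (v - w) ⬝ᵥ (v - w) := Finset.sum_nonneg fun _ _ => mul_self_nonneg _
  rw [sub_dotProduct, dotProduct_sub, dotProduct_sub, dotProduct_comm w v] at h
  linarith

theorem dotProduct_le_of_unit {J : Type*} [Fintype J] {v : J → ℝ} (hv : v ⬝ᵥ v = 1) (g : J → ℝ)
    {a : ℝ} (ha : 0 < a) : v ⬝ᵥ g ≤ a / 2 + ∑ j, g j ^ 2 / a / 2 := by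
  have h : v ⬝ᵥ g ≤ ∑ j, (a / 2 * (v j * v j) + g j ^ 2 / a / 2) := by
    refine Finset.sum_le_sum fun j _ => ?_
    have : 0 ≤ (a * v j - g j) ^ 2 / (2 * a) := by positivity
    have h2 : (a * v j - g j) ^ 2 / (2 * a)
        = a / 2 * (v j * v j) + g j ^ 2 / a / 2 - v j * g j := by
      field_simp; ring
    linarith
  refine h.trans (le_of_eq ?_)
  rw [Finset.sum_add_distrib, ← Finset.mul_sum]
  unfold dotProduct at hv
  rw [hv, mul_one]

section Bilinear

variable {T I J : Type*} [Fintype I] [Fintype J]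

/-- The coefficients of `wᵀ A v + γ`, where `γ` is an independent standard Gaussian variable, in
the independent Gaussian variables `A`, `γ`, `g` and `h`. -/
def bilinearCoeff (v : T → J → ℝ) (w : T → I → ℝ) (i : T) : (I × J) ⊕ (Unit ⊕ (J ⊕ I)) → ℝ :=
  Sum.elim (fun p => w i p.1 * v i p.2) (Sum.elim (fun _ => 1) (Sum.elim (fun _ => 0) fun _ => 0))

/-- The coefficients of `⟨g, v⟩ + ⟨h, w⟩` in the independent Gaussian variables `A`, `γ`, `g` and
`h`. -/
def linearCoeff (v : T → J → ℝ) (w : T → I → ℝ) (i : T) : (I × J) ⊕ (Unit ⊕ (J ⊕ I)) → ℝ :=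
  Sum.elim (fun _ => 0) (Sum.elim (fun _ => 0) (Sum.elim (v i) (w i)))

theorem bilinearCoeff_dotProduct (v : T → J → ℝ) (w : T → I → ℝ) (i : T)
    (x : (I × J) ⊕ (Unit ⊕ (J ⊕ I)) → ℝ) :
    bilinearCoeff v w i ⬝ᵥ x
      = (∑ p : I × J, w i p.1 * v i p.2 * x (Sum.inl p)) + x (Sum.inr (Sum.inl ())) := by
  simp [bilinearCoeff, dotProduct]

theorem linearCoeff_dotProduct (v : T → J → ℝ) (w : T → I → ℝ) (i : T)
    (x : (I × J) ⊕ (Unit ⊕ (J ⊕ I)) → ℝ) :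
    linearCoeff v w i ⬝ᵥ x = (v i ⬝ᵥ fun j => x (Sum.inr (Sum.inr (Sum.inl j))))
      + (w i ⬝ᵥ fun j => x (Sum.inr (Sum.inr (Sum.inr j)))) := by
  simp [linearCoeff, dotProduct]

theorem sum_mul_mul_mul_eq (v v' : J → ℝ) (w w' : I → ℝ) :
    ∑ p : I × J, w p.1 * v p.2 * (w' p.1 * v' p.2) = (w ⬝ᵥ w') * (v ⬝ᵥ v') := by
  rw [Fintype.sum_prod_type, dotProduct, dotProduct, Finset.sum_mul_sum]
  exact Finset.sum_congr rfl fun _ _ => Finset.sum_congr rfl fun _ _ => by ring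

/-- Gordon's comparison of the bilinear process `wᵀ A v + γ` with `⟨g, v⟩ + ⟨h, w⟩` on unit vectors:
the covariances differ by `(1 - ⟨v, v'⟩) (1 - ⟨w, w'⟩) ≥ 0`. -/
theorem integral_partitionFn_bilinearCoeff_le [Fintype T] [Nonempty T] {β r : ℝ} (hβ : 0 ≤ β) (hr0 : 0 ≤ r)
    (hr1 : r ≤ 1) {v : T → J → ℝ} {w : T → I → ℝ} (hv : ∀ i, v i ⬝ᵥ v i = 1)
    (hw : ∀ i, w i ⬝ᵥ w i = 1) :
    ∫ x, partitionFn β (bilinearCoeff v w) x ^ r ∂gaussianPi _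
      ≤ ∫ x, partitionFn β (linearCoeff v w) x ^ r ∂gaussianPi _ := by
  have hbb : ∀ i j, bilinearCoeff v w i ⬝ᵥ bilinearCoeff v w j
      = (w i ⬝ᵥ w j) * (v i ⬝ᵥ v j) + 1 := fun i j => by
    rw [bilinearCoeff_dotProduct, ← sum_mul_mul_mul_eq]
    simp [bilinearCoeff]
  have hll : ∀ i j, linearCoeff v w i ⬝ᵥ linearCoeff v w j
      = (v i ⬝ᵥ v j) + (w i ⬝ᵥ w j) := fun i j => by
    rw [linearCoeff_dotProduct]
    simp [linearCoeff]
  refine integral_partitionFn_rpow_le hβ hr0 hr1 _ _ (fun i j => ?_) (fun i => ?_) fun i j => ?_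
  · rw [bilinearCoeff_dotProduct]
    simp [linearCoeff]
  · rw [hbb, hll, hv, hw]; norm_num
  · rw [hbb, hll]
    nlinarith [mul_nonneg (sub_nonneg.2 (dotProduct_le_one_of_unit (hv i) (hv j)))
      (sub_nonneg.2 (dotProduct_le_one_of_unit (hw i) (hw j)))]

theorem integral_partitionFn_linearCoeff_le [Fintype T] [Nonempty T] [Nonempty I] [Nonempty J] {β r : ℝ}
    (hβ : 0 ≤ β) (hr0 : 0 ≤ r) {v : T → J → ℝ} {w : T → I → ℝ}
    (hv : ∀ i, v i ⬝ᵥ v i = 1) (hw : ∀ i, w i ⬝ᵥ w i = 1) :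
    ∫ x, partitionFn β (linearCoeff v w) x ^ r ∂gaussianPi _
      ≤ (Fintype.card T : ℝ) ^ r *
        Real.exp (r * β * (√(Fintype.card J) + √(Fintype.card I)) + (r * β) ^ 2) := by
  set s : ℝ := r * β with hs
  have hs0 : 0 ≤ s := mul_nonneg hr0 hβ
  set nJ : ℝ := √(Fintype.card J) with hnJ
  set nI : ℝ := √(Fintype.card I) with hnI
  have hJ : 0 < nJ := Real.sqrt_pos.2 (by exact_mod_cast Fintype.card_pos)
  have hI : 0 < nI := Real.sqrt_pos.2 (by exact_mod_cast Fintype.card_pos)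
  have haJ : 0 < s + nJ := by positivity
  have haI : 0 < s + nI := by positivity
  -- A product of functions of single coordinates that dominates `exp (s (‖g‖ + ‖h‖))`.
  let f : (I × J) ⊕ (Unit ⊕ (J ⊕ I)) → ℝ → ℝ :=
    Sum.elim (fun _ _ => 1) (Sum.elim (fun _ _ => 1)
      (Sum.elim (fun _ y => Real.exp (s / (s + nJ) * y ^ 2 / 2))
        (fun _ y => Real.exp (s / (s + nI) * y ^ 2 / 2))))
  have hf : ∀ k, Integrable (f k) (gaussianReal 0 1) := by
    rintro (_ | _ | _ | _)
    · exact integrable_const _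
    · exact integrable_const _
    · exact integrable_exp_mul_sq_gaussianReal (by rw [div_lt_one haJ]; linarith)
    · exact integrable_exp_mul_sq_gaussianReal (by rw [div_lt_one haI]; linarith)
  have hpt : ∀ x, partitionFn β (linearCoeff v w) x ^ r
      ≤ (Fintype.card T : ℝ) ^ r * Real.exp (s * (s + nJ) / 2 + s * (s + nI) / 2)
        * ∏ k, f k (x k) := by
    intro x
    set M : ℝ := ((s + nJ) / 2 + ∑ j, x (Sum.inr (Sum.inr (Sum.inl j))) ^ 2 / (s + nJ) / 2)
      + ((s + nI) / 2 + ∑ j, x (Sum.inr (Sum.inr (Sum.inr j))) ^ 2 / (s + nI) / 2) with hM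
    have h1 : partitionFn β (linearCoeff v w) x ≤ Fintype.card T * Real.exp (β * M) := by
      unfold partitionFn
      refine (Finset.sum_le_card_nsmul _ _ (Real.exp (β * M)) fun i _ => ?_).trans (by simp)
      refine Real.exp_le_exp.2 (mul_le_mul_of_nonneg_left ?_ hβ)
      rw [linearCoeff_dotProduct]
      exact add_le_add (dotProduct_le_of_unit (hv i) _ haJ) (dotProduct_le_of_unit (hw i) _ haI)
    refine (Real.rpow_le_rpow (partitionFn_pos _ _ _).le h1 hr0).trans (le_of_eq ?_)
    rw [Real.mul_rpow (by positivity) (by positivity), ← Real.exp_mul,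
      mul_assoc ((Fintype.card T : ℝ) ^ r)]
    congr 1
    simp only [Fintype.prod_sum_type, f, Sum.elim_inl, Sum.elim_inr, Finset.prod_const_one, one_mul,
      ← Real.exp_sum, ← Real.exp_add]
    congr 1
    have e1 : ∀ a : ℝ, ∀ y : ℝ, s / a * y ^ 2 / 2 = s * (y ^ 2 / a / 2) := fun a y => by ring
    simp only [e1, ← Finset.mul_sum]
    rw [show β * M * r = s * M by rw [hs]; ring, hM]
    ring
  calc ∫ x, partitionFn β (linearCoeff v w) x ^ r ∂gaussianPi _
      ≤ ∫ x, (Fintype.card T : ℝ) ^ r * Real.exp (s * (s + nJ) / 2 + s * (s + nI) / 2)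
        * ∏ k, f k (x k) ∂gaussianPi _ :=
        integral_mono_of_nonneg
          (ae_of_all _ fun x => Real.rpow_nonneg (partitionFn_pos _ _ _).le _)
          ((Integrable.fintype_prod_dep hf).const_mul _) (ae_of_all _ hpt)
    _ = (Fintype.card T : ℝ) ^ r * (Real.exp (s * (s + nJ) / 2 + s * (s + nI) / 2)
        * ((√(1 - s / (s + nJ)))⁻¹ ^ Fintype.card J * (√(1 - s / (s + nI)))⁻¹ ^ Fintype.card I)) := by
        rw [integral_const_mul, integral_fintype_prod_eq_prod (f := f)]
        simp [Fintype.prod_sum_type, f, integral_exp_mul_sq_gaussianReal, mul_assoc]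
    _ ≤ _ := by
        refine mul_le_mul_of_nonneg_left ?_ (by positivity)
        refine (mul_le_mul_of_nonneg_left (mul_le_mul
          (inv_sqrt_one_sub_div_pow_le hs0 Fintype.card_pos)
          (inv_sqrt_one_sub_div_pow_le hs0 Fintype.card_pos)
          (by positivity) (by positivity)) (by positivity)).trans (le_of_eq ?_)
        rw [← Real.exp_add, ← Real.exp_add]
        congr 1
        ring

/-- Chernoff's inequality for the soft maximum of the bilinear process. -/
theorem real_mul_exp_le_integral_partitionFn_bilinearCoeff [Fintype T] [Nonempty T] {β r : ℝ} (hβ : 0 ≤ β)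
    (hr0 : 0 ≤ r) (hr1 : r ≤ 1) (v : T → J → ℝ) (w : T → I → ℝ) (α : ℝ) :
    (gaussianPi (I × J)).real {x | ∃ i, α < ∑ p : I × J, w i p.1 * v i p.2 * x p}
        * Real.exp (r * β * α + (r * β) ^ 2 / 2)
      ≤ ∫ x, partitionFn β (bilinearCoeff v w) x ^ r ∂gaussianPi _ := by
  set s : ℝ := r * β with hs
  have hs0 : 0 ≤ s := mul_nonneg hr0 hβ
  set E : Set (I × J → ℝ) := {x | ∃ i, α < ∑ p : I × J, w i p.1 * v i p.2 * x p} with hE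
  have hEm : MeasurableSet E := by
    have : E = ⋃ i, {x | α < ∑ p : I × J, w i p.1 * v i p.2 * x p} := by ext; simp [hE]
    rw [this]
    exact MeasurableSet.iUnion fun i => measurableSet_lt (by fun_prop) (by fun_prop)
  have hm : Measurable fun y : Unit ⊕ (J ⊕ I) → ℝ => Real.exp (s * y (Sum.inl ())) := by fun_prop
  have hγ : ∫ y : Unit ⊕ (J ⊕ I) → ℝ, Real.exp (s * y (Sum.inl ())) ∂gaussianPi _
      = Real.exp (s ^ 2 / 2) := by
    have h1 := congrFun (mgf_fun_id_gaussianReal (μ := 0) (v := 1)) s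
    simp only [mgf, zero_mul, NNReal.coe_one, one_mul, zero_add] at h1
    rw [← h1, ← (measurePreserving_eval (fun _ : Unit ⊕ (J ⊕ I) => gaussianReal 0 1)
      (Sum.inl ())).map_eq, integral_map (measurable_pi_apply _).aemeasurable (by fun_prop)]
  have hint : Integrable (fun x => partitionFn β (bilinearCoeff v w) x ^ r) (gaussianPi _) := by
    refine integrable_gaussianPi_of_le_exp (by fun_prop) (Fintype.card T)
      (β * ∑ i, ∑ k, |bilinearCoeff v w i k|) fun x => ?_
    rw [abs_of_nonneg (Real.rpow_nonneg (partitionFn_pos _ _ _).le _)]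
    refine partitionFn_rpow_le hβ hr0 hr1 (fun i k => ?_) x
    exact (Finset.single_le_sum (f := fun k => |bilinearCoeff v w i k|)
        (fun _ _ => abs_nonneg _) (Finset.mem_univ k)).trans
      (Finset.single_le_sum (f := fun i => ∑ k, |bilinearCoeff v w i k|)
        (fun _ _ => Finset.sum_nonneg fun _ _ => abs_nonneg _) (Finset.mem_univ i))
  calc (gaussianPi (I × J)).real E * Real.exp (s * α + s ^ 2 / 2)
      = (∫ x, E.indicator (fun _ => Real.exp (s * α)) x ∂gaussianPi (I × J))
        * ∫ y : Unit ⊕ (J ⊕ I) → ℝ, Real.exp (s * y (Sum.inl ())) ∂gaussianPi _ := by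
        rw [hγ, integral_indicator_const _ hEm, Real.exp_add, smul_eq_mul]
        ring
    _ = ∫ x, E.indicator (fun _ => Real.exp (s * α)) (fun p => x (Sum.inl p))
        * Real.exp (s * x (Sum.inr (Sum.inl ()))) ∂gaussianPi ((I × J) ⊕ (Unit ⊕ (J ⊕ I))) :=
        (integral_gaussianPi_sum_mul _ _ (measurable_const.indicator hEm) hm).symm
    _ ≤ _ := by
        refine integral_mono_of_nonneg (ae_of_all _ fun x => ?_) hint (ae_of_all _ fun x => ?_)
        · exact mul_nonneg (Set.indicator_nonneg (fun _ _ => (Real.exp_pos _).le) _)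
            (Real.exp_pos _).le
        · simp only
          by_cases hx : (fun p => x (Sum.inl p)) ∈ E
          · rw [Set.indicator_of_mem hx, ← Real.exp_add]
            obtain ⟨i, hi⟩ := hx
            refine le_trans ?_ (Real.rpow_le_rpow (Real.exp_pos _).le
              (exp_le_partitionFn β (bilinearCoeff v w) x i) hr0)
            rw [← Real.exp_mul, bilinearCoeff_dotProduct]
            refine Real.exp_le_exp.2 ?_
            rw [mul_comm _ r, ← mul_assoc, ← hs, mul_add]
            have := mul_le_mul_of_nonneg_left hi.le hs0
            linarith
          · rw [Set.indicator_of_notMem hx, zero_mul]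
            exact Real.rpow_nonneg (partitionFn_pos _ _ _).le _

/-- Tail bound for the maximum of a Gaussian bilinear form over finitely many pairs of unit
vectors. -/
theorem real_exists_lt_bilinear_le [Fintype T] [Nonempty T] [Nonempty I] [Nonempty J]
    {v : T → J → ℝ} {w : T → I → ℝ} (hv : ∀ i, v i ⬝ᵥ v i = 1) (hw : ∀ i, w i ⬝ᵥ w i = 1)
    {s : ℝ} (hs : 0 ≤ s) :
    (gaussianPi (I × J)).real {x | ∃ i, √(Fintype.card J) + √(Fintype.card I) + s
        < ∑ p : I × J, w i p.1 * v i p.2 * x p} ≤ Real.exp (-(s ^ 2 / 2)) := by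
  set α : ℝ := √(Fintype.card J) + √(Fintype.card I) + s with hα
  set p : ℝ := (gaussianPi (I × J)).real
    {x | ∃ i, α < ∑ p : I × J, w i p.1 * v i p.2 * x p} with hp
  have key : ∀ N : ℕ, p ≤ (Fintype.card T : ℝ) ^ ((1 : ℝ) / (N + 1)) * Real.exp (-(s ^ 2 / 2)) := by
    intro N
    have hr0 : (0 : ℝ) ≤ 1 / (N + 1) := by positivity
    have hr1 : (1 : ℝ) / (N + 1) ≤ 1 := by
      rw [div_le_one (by positivity)]; linarith [(Nat.cast_nonneg N : (0 : ℝ) ≤ N)]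
    have hβ : (0 : ℝ) ≤ s * (N + 1) := by positivity
    have hrβ : (1 : ℝ) / (N + 1) * (s * (N + 1)) = s := by field_simp
    have h := (real_mul_exp_le_integral_partitionFn_bilinearCoeff hβ hr0 hr1 v w α).trans
      ((integral_partitionFn_bilinearCoeff_le hβ hr0 hr1 hv hw).trans
        (integral_partitionFn_linearCoeff_le hβ hr0 hv hw))
    rw [hrβ, ← hp, ← le_div_iff₀ (Real.exp_pos _), mul_div_assoc, ← Real.exp_sub] at h
    refine h.trans (le_of_eq ?_)
    congr 2
    rw [hα]
    ring
  -- Let the inverse temperature tend to infinity, to remove the cardinality.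
  have hlim : Filter.Tendsto (fun N : ℕ => (Fintype.card T : ℝ) ^ ((1 : ℝ) / (N + 1))
      * Real.exp (-(s ^ 2 / 2))) Filter.atTop (nhds ((Fintype.card T : ℝ) ^ (0 : ℝ)
        * Real.exp (-(s ^ 2 / 2)))) :=
    (((Real.continuous_const_rpow (by exact_mod_cast Fintype.card_ne_zero)).tendsto 0).comp
      tendsto_one_div_add_atTop_nhds_zero_nat).mul_const _
  simpa using ge_of_tendsto' hlim key

end Bilinear

/-- The largest singular value of a standard Gaussian matrix exceeds `√n + √d + s` with probability
at most `exp (-s² / 2)`. The singular value is expressed through the bilinear form. -/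
theorem measure_exists_unit_lt_bilinear_le {I J : Type*} [Fintype I] [Fintype J] {s : ℝ}
    (hs : 0 ≤ s) :
    gaussianPi (I × J) {x | ∃ (v : J → ℝ) (w : I → ℝ), v ⬝ᵥ v = 1 ∧ w ⬝ᵥ w = 1 ∧
        √(Fintype.card J) + √(Fintype.card I) + s < ∑ p : I × J, w p.1 * v p.2 * x p}
      ≤ ENNReal.ofReal (Real.exp (-(s ^ 2 / 2))) := by
  set α : ℝ := √(Fintype.card J) + √(Fintype.card I) + s with hα
  let S : Type _ := {q : (J → ℝ) × (I → ℝ) // q.1 ⬝ᵥ q.1 = 1 ∧ q.2 ⬝ᵥ q.2 = 1}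
  rcases isEmpty_or_nonempty S with hS | hS
  · refine (le_of_eq (measure_mono_null ?_ measure_empty)).trans bot_le
    rintro x ⟨v, w, hv, hw, -⟩
    exact (hS.false ⟨(v, w), hv, hw⟩).elim
  have hJ : Nonempty J := by
    obtain ⟨q⟩ := hS
    by_contra h
    rw [not_nonempty_iff] at h
    simpa [dotProduct] using q.2.1
  have hI : Nonempty I := by
    obtain ⟨q⟩ := hS
    by_contra h
    rw [not_nonempty_iff] at h
    simpa [dotProduct] using q.2.2
  let e : ℕ → S := TopologicalSpace.denseSeq S
  let E : ℕ → Set (I × J → ℝ) := fun N =>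
    {x | ∃ i : Fin (N + 1), α < ∑ p : I × J, (e i).1.2 p.1 * (e i).1.1 p.2 * x p}
  have hEmono : Monotone E := by
    intro N M hNM x
    rintro ⟨i, hi⟩
    exact ⟨Fin.castLE (by omega) i, hi⟩
  have hsub : {x : I × J → ℝ | ∃ (v : J → ℝ) (w : I → ℝ), v ⬝ᵥ v = 1 ∧ w ⬝ᵥ w = 1 ∧
      α < ∑ p : I × J, w p.1 * v p.2 * x p} ⊆ ⋃ N, E N := by
    rintro x ⟨v, w, hv, hw, hlt⟩
    have hopen : IsOpen {q : S | α < ∑ p : I × J, q.1.2 p.1 * q.1.1 p.2 * x p} :=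
      isOpen_lt (by fun_prop) (by fun_prop)
    obtain ⟨_, hq, N, rfl⟩ := (TopologicalSpace.denseRange_denseSeq S).exists_mem_open hopen
      ⟨⟨(v, w), hv, hw⟩, hlt⟩ |>.elim fun N hN => (⟨e N, hN, N, rfl⟩ :
        ∃ q : S, q ∈ {q : S | α < ∑ p : I × J, q.1.2 p.1 * q.1.1 p.2 * x p} ∧ ∃ N, e N = q)
    exact Set.mem_iUnion.2 ⟨N, ⟨N, Nat.lt_succ_self N⟩, hq⟩
  refine (measure_mono hsub).trans ?_
  rw [hEmono.measure_iUnion]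
  refine iSup_le fun N => ?_
  rw [← ENNReal.ofReal_toReal (measure_ne_top (gaussianPi (I × J)) (E N))]
  exact ENNReal.ofReal_le_ofReal
    (real_exists_lt_bilinear_le (T := Fin (N + 1)) (v := fun i => (e i).1.1)
      (w := fun i => (e i).1.2) (fun i => (e i).2.1) (fun i => (e i).2.2) hs)

/-! ### The image of a fixed vector under a Gaussian matrix -/

/-- The image `A u` of a unit vector under a standard Gaussian matrix is a standard Gaussian
vector. -/
theorem map_mulVec_gaussianPi {I J : Type*} [Fintype I] [Fintype J] {u : J → ℝ}
    (hu : u ⬝ᵥ u = 1) :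
    (gaussianPi (I × J)).map (fun x i => ∑ j, x (i, j) * u j) = gaussianPi I := by
  have hm : Measurable fun (x : I × J → ℝ) i => ∑ j, x (i, j) * u j := by fun_prop
  suffices h : ((gaussianPi (I × J)).map (fun x i => ∑ j, x (i, j) * u j)).map
      (MeasurableEquiv.toLp 2 (I → ℝ)) = (gaussianPi I).map (MeasurableEquiv.toLp 2 (I → ℝ)) from
    (MeasurableEquiv.toLp 2 (I → ℝ)).map_measurableEquiv_injective h
  simp only [MeasurableEquiv.coe_toLp]
  refine Measure.ext_of_charFun (funext fun t => ?_)
  rw [Measure.map_map (by fun_prop) hm, map_pi_eq_stdGaussian, charFun_stdGaussian, charFun_apply,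
    integral_map ((WithLp.measurable_toLp 2 _).comp hm).aemeasurable (by fun_prop)]
  have key := charFun_stdGaussian (E := EuclideanSpace ℝ (I × J))
    (WithLp.toLp 2 fun p => t p.1 * u p.2)
  rw [← map_pi_eq_stdGaussian, charFun_apply,
    integral_map (WithLp.measurable_toLp 2 _).aemeasurable (by fun_prop)] at key
  have hnorm : ‖(WithLp.toLp 2 fun p => t p.1 * u p.2 : EuclideanSpace ℝ (I × J))‖ ^ 2
      = ‖t‖ ^ 2 := by
    rw [EuclideanSpace.real_norm_sq_eq, EuclideanSpace.real_norm_sq_eq]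
    have := sum_mul_mul_mul_eq u u t.ofLp t.ofLp
    rw [hu, mul_one] at this
    simpa [dotProduct, sq] using this
  have e1 : (‖(WithLp.toLp 2 fun p => t p.1 * u p.2 : EuclideanSpace ℝ (I × J))‖ : ℂ) ^ 2
      = (‖t‖ : ℂ) ^ 2 := by exact_mod_cast hnorm
  rw [e1] at key
  rw [← key]
  congr 1
  ext x
  congr 3
  simp only [Function.comp_apply, PiLp.inner_apply, RCLike.inner_apply, conj_trivial,
    Fintype.sum_prod_type, Finset.mul_sum]
  exact Finset.sum_congr rfl fun i _ => Finset.sum_congr rfl fun j _ => by ring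

/-- Lower tail of the chi-squared distribution. -/
theorem measureReal_sum_sq_lt_le {I : Type*} [Fintype I] {t : ℝ} (ht0 : 0 < t) (ht1 : t < 1) :
    (gaussianPi I).real {y | ∑ i, y i ^ 2 < Fintype.card I * (1 - t)}
      ≤ Real.exp ((Fintype.card I : ℝ) / 2 * (t + Real.log (1 - t))) := by
  have h1t : 0 < 1 - t := by linarith
  -- The exponent `-t / (1 - t)` is optimal in Chernoff's inequality.
  set s : ℝ := -(t / (1 - t)) with hs
  have hs0 : s < 0 := by rw [hs, neg_lt_zero]; positivity
  have hs1 : 1 - s = (1 - t)⁻¹ := by rw [hs]; field_simp; ring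
  have hst : s * (1 - t) = -t := by rw [hs]; field_simp
  have hint : Integrable (fun y : I → ℝ => ∏ i, Real.exp (s * y i ^ 2 / 2)) (gaussianPi I) :=
    Integrable.fintype_prod fun _ => integrable_exp_mul_sq_gaussianReal (by linarith)
  have hmarkov := mul_meas_ge_le_integral_of_nonneg
    (ae_of_all _ fun y => Finset.prod_nonneg fun i _ => (Real.exp_pos _).le) hint
    (Real.exp (-(Fintype.card I * t / 2)))
  rw [integral_fintype_prod_eq_prod (f := fun (_ : I) y => Real.exp (s * y ^ 2 / 2))] at hmarkov
  simp only [integral_exp_mul_sq_gaussianReal, hs1, Finset.prod_const, Finset.card_univ] at hmarkov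
  have hmono : (gaussianPi I).real {y | ∑ i, y i ^ 2 < Fintype.card I * (1 - t)}
      ≤ (gaussianPi I).real {y | Real.exp (-(Fintype.card I * t / 2))
        ≤ ∏ i, Real.exp (s * y i ^ 2 / 2)} := by
    refine measureReal_mono fun y hy => ?_
    simp only [Set.mem_ofPred_eq] at hy ⊢
    rw [← Real.exp_sum, Real.exp_le_exp, ← Finset.sum_div, ← Finset.mul_sum]
    have := mul_le_mul_of_nonpos_left hy.le hs0.le
    rw [mul_left_comm, hst] at this
    linarith
  refine hmono.trans ?_
  rw [mul_comm, ← le_div_iff₀ (Real.exp_pos _)] at hmarkov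
  refine hmarkov.trans (le_of_eq ?_)
  rw [Real.sqrt_inv, inv_inv, div_eq_mul_inv, ← Real.exp_neg, neg_neg]
  have : √(1 - t) = Real.exp (Real.log (1 - t) / 2) := by
    rw [Real.exp_half, Real.exp_log h1t]
  rw [this, ← Real.exp_nat_mul, ← Real.exp_add]
  congr 1
  ring

/-- A standard Gaussian matrix shrinks a fixed vector by a factor less than `√(d (1 - t))` with
exponentially small probability. -/
theorem measureReal_sum_mulVec_sq_lt_le {I J : Type*} [Fintype I] [Fintype J] (z : J → ℝ)
    {t : ℝ} (ht0 : 0 < t) (ht1 : t < 1) :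
    (gaussianPi (I × J)).real
        {x | ∑ i, (∑ j, x (i, j) * z j) ^ 2 < Fintype.card I * (1 - t) * (z ⬝ᵥ z)}
      ≤ Real.exp ((Fintype.card I : ℝ) / 2 * (t + Real.log (1 - t))) := by
  have hz0 : 0 ≤ z ⬝ᵥ z := Finset.sum_nonneg fun _ _ => mul_self_nonneg _
  rcases hz0.eq_or_lt with hz | hz
  · refine (le_of_eq ?_).trans (Real.exp_pos _).le
    rw [← hz, mul_zero]
    convert measureReal_empty
    ext x
    simpa using Finset.sum_nonneg fun i _ => sq_nonneg _
  set N : ℝ := √(z ⬝ᵥ z) with hN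
  have hNpos : 0 < N := Real.sqrt_pos.2 hz
  have hNsq : z ⬝ᵥ z = N ^ 2 := (Real.sq_sqrt hz0).symm
  have hu : (N⁻¹ • z) ⬝ᵥ (N⁻¹ • z) = 1 := by
    rw [smul_dotProduct, dotProduct_smul, hNsq]
    simp only [smul_eq_mul]
    field_simp
  refine le_trans (le_of_eq ?_) (measureReal_sum_sq_lt_le (I := I) ht0 ht1)
  rw [← map_mulVec_gaussianPi (I := I) hu, measureReal_def, measureReal_def,
    Measure.map_apply (by fun_prop) (measurableSet_lt (by fun_prop) (by fun_prop))]
  congr 2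
  ext x
  simp only [Set.mem_ofPred_eq, Set.preimage_ofPred_eq, Pi.smul_apply, smul_eq_mul]
  have : ∑ i, (∑ j, x (i, j) * (N⁻¹ * z j)) ^ 2
      = (∑ i, (∑ j, x (i, j) * z j) ^ 2) / N ^ 2 := by
    rw [Finset.sum_div]
    refine Finset.sum_congr rfl fun i _ => ?_
    rw [← div_pow, Finset.sum_div]
    congr 1
    exact Finset.sum_congr rfl fun j _ => by field_simp
  rw [this, div_lt_iff₀ (by positivity), hNsq]

/-! ### Counting the vectors of low complexity -/

/-- A prefix-free set contains at most `2 ^ k` strings of length at most `k`, since padding to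
length `k` is injective on it. -/
theorem ncard_le_two_pow_of_prefix_free {S : Set (List Bool)} {k : ℕ}
    (hlen : ∀ p ∈ S, p.length ≤ k) (hS : ∀ p ∈ S, ∀ q ∈ S, p <+: q → p = q) :
    S.Finite ∧ S.ncard ≤ 2 ^ k := by
  let pad : List Bool → (Fin k → Bool) := fun p i => p.getD i false
  have hinj : Set.InjOn pad S := by
    intro p hp q hq hpq
    have hget : ∀ i, p.getD i false = q.getD i false := by
      intro i
      by_cases hi : i < k
      · exact congrFun hpq ⟨i, hi⟩
      · have h1 := hlen p hp
        have h2 := hlen q hq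
        rw [List.getD_eq_default _ _ (by omega), List.getD_eq_default _ _ (by omega)]
    have hpre : ∀ {p q : List Bool}, (∀ i, p.getD i false = q.getD i false) →
        p.length ≤ q.length → p <+: q := by
      intro p q h hl
      rw [List.prefix_iff_eq_take]
      refine List.ext_getElem (by simp [hl]) fun i h1 h2 => ?_
      have := h i
      rw [List.getD_eq_getElem _ _ h1, List.getD_eq_getElem _ _ (by omega)] at this
      simpa using this
    rcases le_total p.length q.length with h | h
    · exact hS p hp q hq (hpre hget h)
    · exact (hS q hq p hp (hpre (fun i => (hget i).symm) h)).symm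
  have hfin : S.Finite := Set.Finite.of_finite_image (Set.toFinite (pad '' S)) hinj
  refine ⟨hfin, ?_⟩
  rw [← hinj.ncard_image]
  refine (Set.ncard_le_ncard (Set.subset_univ _) Set.finite_univ).trans ?_
  rw [Set.ncard_univ, Nat.card_eq_fintype_card]
  simp

theorem IsBinaryExpansion.unique {n : ℕ} {w : List Bool} {u u' : EuclideanSpace ℝ (Fin n)}
    (h : IsBinaryExpansion w u) (h' : IsBinaryExpansion w u') : u = u' := by
  obtain ⟨l, hl, hu⟩ := h
  obtain ⟨l', hl', hu'⟩ := h'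
  ext i
  have hn : 0 < n := i.pos
  have : l = l' := Nat.eq_of_mul_eq_mul_left hn (hl.symm.trans hl')
  subst this
  rw [hu, hu']

/-- The points of the unit cube with a program of length at most `κ m`: the possible quantizations
of the vectors of complexity at most `κ m` at resolution `m`. -/
def lowComplexityGrid (U : Machine (ℕ × ℕ)) (m n : ℕ) (κ : ℝ) : Set (EuclideanSpace ℝ (Fin n)) :=
  {u | (∀ i, u i ∈ Set.Icc (0 : ℝ) 1) ∧ ∃ (w : List Bool) (p : List Bool),
    IsBinaryExpansion w u ∧ w ∈ U p (n, m) ∧ (p.length : ℝ) ≤ κ * m}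

theorem hasComplexityAtMost_iff {U : Machine (ℕ × ℕ)} {m n : ℕ} {κ : ℝ}
    {x : EuclideanSpace ℝ (Fin n)} :
    HasComplexityAtMost U m κ x ↔
      ∃ u ∈ lowComplexityGrid U m n κ, ∀ i, |x i - u i| ≤ (2 : ℝ)⁻¹ ^ m := by
  have hcoe : ∀ k : ℕ, ((((k : ℕ∞) : ENNReal) : EReal) ≤ ((κ * m : ℝ) : EReal)) ↔
      (k : ℝ) ≤ κ * m := by
    intro k
    have : (((k : ℕ∞) : ENNReal) : EReal) = ((k : ℝ) : EReal) := by
      rw [ENat.toENNReal_coe, ← ENNReal.coe_natCast]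
      rfl
    rw [this, EReal.coe_le_coe_iff]
  constructor
  · intro h
    unfold HasComplexityAtMost at h
    obtain ⟨k, hk⟩ : ∃ k : ℕ, quantizedComplexity U m x = k := by
      refine ENat.ne_top_iff_exists.1 (fun htop => ?_) |>.imp fun k hk => hk.symm
      rw [htop] at h
      simp [-EReal.coe_mul] at h
    rw [hk, hcoe] at h
    have hlt : quantizedComplexity U m x < ((k + 1 : ℕ) : ℕ∞) := by
      rw [hk]; exact_mod_cast Nat.lt_succ_self k
    unfold quantizedComplexity vectorComplexity condComplexity at hlt
    simp only [iInf_lt_iff] at hlt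
    obtain ⟨u, hu1, hu2, w, hw, p, hp, hlen⟩ := hlt
    have hlen' : p.length ≤ k := by
      have : p.length < k + 1 := by exact_mod_cast hlen
      omega
    exact ⟨u, ⟨hu1, w, p, hw, hp, le_trans (by exact_mod_cast hlen') h⟩, hu2⟩
  · rintro ⟨u, ⟨hu1, w, p, hw, hp, hlen⟩, hu2⟩
    have hle : quantizedComplexity U m x ≤ (p.length : ℕ∞) := by
      unfold quantizedComplexity vectorComplexity condComplexity
      exact iInf_le_of_le u (iInf_le_of_le hu1 (iInf_le_of_le hu2 (iInf_le_of_le w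
        (iInf_le_of_le hw (iInf_le_of_le p (iInf_le _ hp))))))
    refine le_trans ?_ ((hcoe p.length).2 hlen)
    exact_mod_cast hle

/-- Distinct grid points need distinct programs, and these form a prefix-free set. -/
theorem lowComplexityGrid_finite_and_ncard_le {U : Machine (ℕ × ℕ)} (hU : IsPrefixMachine U)
    (m n : ℕ) (κ : ℝ) :
    (lowComplexityGrid U m n κ).Finite ∧
      ((lowComplexityGrid U m n κ).ncard : ℝ) ≤ (2 : ℝ) ^ (κ * m) := by
  rcases lt_or_ge (κ * m) 0 with hneg | hpos
  · have : lowComplexityGrid U m n κ = ∅ := by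
      refine Set.eq_empty_of_forall_notMem fun u hu => ?_
      obtain ⟨-, w, p, -, -, hlen⟩ := hu
      have : (0 : ℝ) ≤ p.length := Nat.cast_nonneg _
      linarith
    rw [this]
    exact ⟨Set.finite_empty, by simpa using Real.rpow_nonneg (by norm_num) _⟩
  let S : Set (List Bool) := {p | p.length ≤ ⌊κ * m⌋₊ ∧ (U p (n, m)).Dom}
  obtain ⟨hSfin, hScard⟩ := ncard_le_two_pow_of_prefix_free (S := S) (k := ⌊κ * m⌋₊)
    (fun p hp => hp.1) fun p hp q hq => hU.prefix_free (n, m) p q hp.2 hq.2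
  have hex : ∀ u ∈ lowComplexityGrid U m n κ, ∃ p ∈ S, ∃ w ∈ U p (n, m), IsBinaryExpansion w u := by
    rintro u ⟨-, w, p, hw, hp, hlen⟩
    exact ⟨p, ⟨Nat.le_floor hlen, Part.dom_iff_mem.2 ⟨w, hp⟩⟩, w, hp, hw⟩
  choose! f hf using hex
  have hmaps : Set.MapsTo f (lowComplexityGrid U m n κ) S := fun u hu => (hf u hu).1
  have hinj : Set.InjOn f (lowComplexityGrid U m n κ) := by
    intro u hu u' hu' he
    obtain ⟨w, hw, hb⟩ := (hf u hu).2
    obtain ⟨w', hw', hb'⟩ := (hf u' hu').2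
    rw [he] at hw
    rw [Part.mem_unique hw hw'] at hb
    exact hb.unique hb'
  refine ⟨Set.Finite.of_injOn hmaps hinj hSfin, ?_⟩
  have h1 := (Set.ncard_le_ncard_of_injOn f hmaps hinj hSfin).trans hScard
  calc ((lowComplexityGrid U m n κ).ncard : ℝ) ≤ (2 : ℝ) ^ ⌊κ * m⌋₊ := by exact_mod_cast h1
    _ = (2 : ℝ) ^ ((⌊κ * m⌋₊ : ℕ) : ℝ) := (Real.rpow_natCast _ _).symm
    _ ≤ _ := Real.rpow_le_rpow_of_exponent_le (by norm_num) (Nat.floor_le hpos)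

/-- The feasible set is a finite union of closed boxes, intersected with a closed set. -/
theorem isCompact_feasible {U : Machine (ℕ × ℕ)} (hU : IsPrefixMachine U) (m : ℕ) {n : ℕ} (κ : ℝ)
    {D : Set (EuclideanSpace ℝ (Fin n))} (hD : IsClosed D) :
    IsCompact {x | x ∈ D ∧ HasComplexityAtMost U m κ x} := by
  have hbox : ∀ u : EuclideanSpace ℝ (Fin n),
      IsCompact {x : EuclideanSpace ℝ (Fin n) | ∀ i, |x i - u i| ≤ (2 : ℝ)⁻¹ ^ m} := by
    intro u
    have h : IsCompact (Set.univ.pi fun i => Metric.closedBall (u i) ((2 : ℝ)⁻¹ ^ m)) :=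
      isCompact_univ_pi fun i => isCompact_closedBall _ _
    convert (EuclideanSpace.equiv (Fin n) ℝ).toHomeomorph.isCompact_preimage.2 h using 1
    ext x
    simp [Set.mem_pi, Real.dist_eq]
  have : {x | x ∈ D ∧ HasComplexityAtMost U m κ x} = (⋃ u ∈ lowComplexityGrid U m n κ,
      {x : EuclideanSpace ℝ (Fin n) | ∀ i, |x i - u i| ≤ (2 : ℝ)⁻¹ ^ m}) ∩ D := by
    ext x
    simp [hasComplexityAtMost_iff, and_comm]
  rw [this]
  exact ((lowComplexityGrid_finite_and_ncard_le hU m n κ).1.isCompact_biUnion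
    fun u _ => hbox u).inter_right hD

theorem norm_sub_le_of_abs_sub_le {n : ℕ} {x u : EuclideanSpace ℝ (Fin n)} {q : ℝ} (hq : 0 ≤ q)
    (h : ∀ i, |x i - u i| ≤ q) : ‖x - u‖ ≤ q * √n := by
  rw [EuclideanSpace.norm_eq, ← Real.sqrt_sq hq, ← Real.sqrt_mul (sq_nonneg q)]
  refine Real.sqrt_le_sqrt ((Finset.sum_le_card_nsmul _ _ (q ^ 2) fun i _ => ?_).trans_eq ?_)
  · simpa using pow_le_pow_left₀ (abs_nonneg _) (h i) 2
  · simp [mul_comm]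

/-! ### Recovery by constrained least squares -/

theorem toEuclideanLin_apply_eq_sum {d n : ℕ} (B : Matrix (Fin d) (Fin n) ℝ)
    (x : EuclideanSpace ℝ (Fin n)) (i : Fin d) :
    B.toEuclideanLin x i = ∑ j, B i j * x j := by
  simp [Matrix.toLpLin_apply, Matrix.mulVec, dotProduct]

theorem norm_toEuclideanLin_le {d n : ℕ} {B : Matrix (Fin d) (Fin n) ℝ} {σ : ℝ} (hσ : 0 ≤ σ)
    (h : ∀ (v : Fin n → ℝ) (w : Fin d → ℝ), v ⬝ᵥ v = 1 → w ⬝ᵥ w = 1 →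
      ∑ p : Fin d × Fin n, w p.1 * v p.2 * B p.1 p.2 ≤ σ) (x : EuclideanSpace ℝ (Fin n)) :
    ‖B.toEuclideanLin x‖ ≤ σ * ‖x‖ := by
  set y := B.toEuclideanLin x with hy
  rcases eq_or_ne y 0 with h0 | h0
  · rw [h0, norm_zero]; positivity
  have hx0 : x ≠ 0 := by
    rintro rfl
    exact h0 (by rw [hy, map_zero])
  have hyn : 0 < ‖y‖ := norm_pos_iff.2 h0
  have hxn : 0 < ‖x‖ := norm_pos_iff.2 hx0
  have hunit : ∀ {k : ℕ} (z : EuclideanSpace ℝ (Fin k)), 0 < ‖z‖ →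
      (fun i => ‖z‖⁻¹ * z i) ⬝ᵥ (fun i => ‖z‖⁻¹ * z i) = 1 := by
    intro k z hz
    have h1 := EuclideanSpace.real_norm_sq_eq z
    have h2 : (fun i => ‖z‖⁻¹ * z i) ⬝ᵥ (fun i => ‖z‖⁻¹ * z i) = ‖z‖⁻¹ ^ 2 * ∑ i, z i ^ 2 := by
      rw [dotProduct, Finset.mul_sum]
      exact Finset.sum_congr rfl fun i _ => by ring
    rw [h2, ← h1]
    field_simp
  have key := h _ _ (hunit x hxn) (hunit y hyn)
  have hsum : ∑ p : Fin d × Fin n, ‖y‖⁻¹ * y p.1 * (‖x‖⁻¹ * x p.2) * B p.1 p.2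
      = ‖y‖⁻¹ * ‖x‖⁻¹ * ∑ i, y i ^ 2 := by
    rw [Fintype.sum_prod_type, Finset.mul_sum]
    refine Finset.sum_congr rfl fun i _ => ?_
    have : y i ^ 2 = y i * ∑ j, B i j * x j := by
      rw [← toEuclideanLin_apply_eq_sum, ← hy, sq]
    rw [this, Finset.mul_sum, Finset.mul_sum]
    exact Finset.sum_congr rfl fun j _ => by ring
  rw [hsum, ← EuclideanSpace.real_norm_sq_eq] at key
  have : ‖y‖⁻¹ * ‖x‖⁻¹ * ‖y‖ ^ 2 = ‖y‖ / ‖x‖ := by field_simp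
  rw [this, div_le_iff₀ hxn] at key
  exact key

theorem exists_isLowComplexityLeastSquares {U : Machine (ℕ × ℕ)} (hU : IsPrefixMachine U) (m : ℕ)
    {d n : ℕ} (κ : ℝ) {D : Set (EuclideanSpace ℝ (Fin n))} (hD : IsClosed D)
    (hne : ∃ x ∈ D, HasComplexityAtMost U m κ x) (B : Matrix (Fin d) (Fin n) ℝ)
    (y : EuclideanSpace ℝ (Fin d)) : ∃ z, IsLowComplexityLeastSquares U m κ D B y z := by
  obtain ⟨x, hx⟩ := hne
  have hcont : Continuous fun z : EuclideanSpace ℝ (Fin n) => ‖y - B.toEuclideanLin z‖ ^ 2 := by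
    have := B.toEuclideanLin.continuous_of_finiteDimensional
    fun_prop
  obtain ⟨z, hz, hmin⟩ := (isCompact_feasible hU m κ hD).exists_isMinOn ⟨x, hx⟩ hcont.continuousOn
  exact ⟨z, hz.1, hz.2, fun x hxD hxK => hmin ⟨hxD, hxK⟩⟩

/-- The deterministic part of the recovery guarantee: if `B` has norm at most `√n + 2 √d` and does
not shrink the vectors from `xo` to the quantization points by more than `√(d (1 - t))`, the
least-squares solution is close to `xo`. -/
theorem norm_sub_le_of_isLowComplexityLeastSquares {U : Machine (ℕ × ℕ)} {m d n : ℕ} (hd : 0 < d)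
    {κ ε t : ℝ} (ht1 : t < 1) {D : Set (EuclideanSpace ℝ (Fin n))}
    {xo xtilde z : EuclideanSpace ℝ (Fin n)} (hxD : xtilde ∈ D) (hclose : ‖xo - xtilde‖ ≤ ε)
    (hK : HasComplexityAtMost U m κ xtilde) {B : Matrix (Fin d) (Fin n) ℝ}
    (hz : IsLowComplexityLeastSquares U m κ D B (B.toEuclideanLin xo) z)
    (hB : ∀ x, ‖B.toEuclideanLin x‖ ≤ (√n + √d + √d) * ‖x‖)
    (hgrid : ∀ u ∈ lowComplexityGrid U m n κ,
      d * (1 - t) * ‖xo - u‖ ^ 2 ≤ ‖B.toEuclideanLin (xo - u)‖ ^ 2) :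
    ‖xo - z‖ ≤ 1 / √(1 - t) * (√((n : ℝ) / d) + 2) * ((2 : ℝ)⁻¹ ^ m * √n + 2 * ε)
      + (2 : ℝ)⁻¹ ^ m * √n := by
  have hε : 0 ≤ ε := (norm_nonneg _).trans hclose
  obtain ⟨u, hu, hzu⟩ := hasComplexityAtMost_iff.1 hz.feasible
  set q : ℝ := (2 : ℝ)⁻¹ ^ m * √n with hq
  have hq0 : 0 ≤ q := by positivity
  have hzu' : ‖z - u‖ ≤ q := norm_sub_le_of_abs_sub_le (by positivity) hzu
  set σ : ℝ := √n + √d + √d with hσ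
  have hσ0 : 0 ≤ σ := by positivity
  have hmin : ‖B.toEuclideanLin (xo - z)‖ ≤ ‖B.toEuclideanLin (xo - xtilde)‖ := by
    rw [map_sub, map_sub]
    exact (pow_le_pow_iff_left₀ (norm_nonneg _) (norm_nonneg _) two_ne_zero).1
      (hz.minimal xtilde hxD hK)
  have hAu : ‖B.toEuclideanLin (xo - u)‖ ≤ σ * (q + 2 * ε) := by
    calc ‖B.toEuclideanLin (xo - u)‖
        = ‖B.toEuclideanLin (xo - z) + B.toEuclideanLin (z - u)‖ := by
          rw [← map_add, sub_add_sub_cancel]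
      _ ≤ ‖B.toEuclideanLin (xo - z)‖ + ‖B.toEuclideanLin (z - u)‖ := norm_add_le _ _
      _ ≤ σ * ε + σ * q := add_le_add
          (hmin.trans ((hB _).trans (mul_le_mul_of_nonneg_left hclose hσ0)))
          ((hB _).trans (mul_le_mul_of_nonneg_left hzu' hσ0))
      _ ≤ σ * (q + 2 * ε) := by nlinarith [mul_nonneg hσ0 hε]
  have hd0 : 0 < √(d : ℝ) := Real.sqrt_pos.2 (by exact_mod_cast hd)
  have ht0 : 0 < √(1 - t) := Real.sqrt_pos.2 (by linarith)
  have hsq : (√d * √(1 - t) * ‖xo - u‖) ^ 2 ≤ ‖B.toEuclideanLin (xo - u)‖ ^ 2 := by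
    rw [mul_pow, mul_pow, Real.sq_sqrt (by positivity), Real.sq_sqrt (by linarith)]
    exact hgrid u hu
  have hlow := ((pow_le_pow_iff_left₀ (by positivity) (norm_nonneg _) two_ne_zero).1 hsq).trans hAu
  have hxu : ‖xo - u‖ ≤ 1 / √(1 - t) * (√((n : ℝ) / d) + 2) * (q + 2 * ε) := by
    rw [mul_comm, ← le_div_iff₀ (by positivity)] at hlow
    refine hlow.trans (le_of_eq ?_)
    rw [Real.sqrt_div (by positivity), hσ]
    field_simp
    ring
  calc ‖xo - z‖ = ‖(xo - u) - (z - u)‖ := by rw [sub_sub_sub_cancel_right]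
    _ ≤ ‖xo - u‖ + ‖z - u‖ := norm_sub_le _ _
    _ ≤ _ := add_le_add hxu hzu'

theorem theorem4 (U : Machine (ℕ × ℕ)) (hU : IsOptimalPrefixMachine U)
    {d n : ℕ} (hd : 0 < d) (m : ℕ) (κ ε t : ℝ) (ht0 : 0 < t) (ht1 : t < 1)
    (D : Set (EuclideanSpace ℝ (Fin n))) (hD : IsClosed D)
    (xo xtilde : EuclideanSpace ℝ (Fin n)) (hxD : xtilde ∈ D)
    (hclose : ‖xo - xtilde‖ ≤ ε) (hK : HasComplexityAtMost U m κ xtilde)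
    {Ω : Type*} [MeasurableSpace Ω] (P : Measure Ω) [IsProbabilityMeasure P]
    (A : Ω → Matrix (Fin d) (Fin n) ℝ) (hA : IsStandardGaussianMatrix P A) :
    (∀ ω, ∃ z, IsLowComplexityLeastSquares U m κ D (A ω) ((A ω).toEuclideanLin xo) z) ∧
    ∀ xhat : Ω → EuclideanSpace ℝ (Fin n),
      (∀ ω, IsLowComplexityLeastSquares U m κ D (A ω) ((A ω).toEuclideanLin xo) (xhat ω)) →
      P.real {ω | 1 / √(1 - t) * (√((n : ℝ) / d) + 2) * ((2 : ℝ)⁻¹ ^ m * √n + 2 * ε)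
            + (2 : ℝ)⁻¹ ^ m * √n < ‖xo - xhat ω‖}
        ≤ (2 : ℝ) ^ (κ * m) * Real.exp ((d : ℝ) / 2 * (t + Real.log (1 - t)))
          + Real.exp (-((d : ℝ) / 2)) := by
  refine ⟨fun ω => exists_isLowComplexityLeastSquares hU.isPrefixMachine m κ hD ⟨xtilde, hxD, hK⟩
    (A ω) _, fun xhat hxhat => ?_⟩
  obtain ⟨hfin, hcard⟩ := lowComplexityGrid_finite_and_ncard_le hU.isPrefixMachine m n κ
  let X : Ω → Fin d × Fin n → ℝ := fun ω p => A ω p.1 p.2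
  have hX : HasLaw X (gaussianPi (Fin d × Fin n)) P :=
    hA.indep.hasLaw_pi fun p => hA.law p.1 p.2
  have hpull : ∀ E : Set (Fin d × Fin n → ℝ),
      P.real (X ⁻¹' E) ≤ (gaussianPi (Fin d × Fin n)).real E := fun E => by
    refine ENNReal.toReal_mono (measure_ne_top _ _) ?_
    rw [← hX.map_eq]
    exact Measure.le_map_apply hX.aemeasurable E
  let Eop : Set (Fin d × Fin n → ℝ) := {x | ∃ (v : Fin n → ℝ) (w : Fin d → ℝ), v ⬝ᵥ v = 1 ∧
    w ⬝ᵥ w = 1 ∧ √n + √d + √d < ∑ p : Fin d × Fin n, w p.1 * v p.2 * x p}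
  let Elow : EuclideanSpace ℝ (Fin n) → Set (Fin d × Fin n → ℝ) := fun u =>
    {x | ∑ i, (∑ j, x (i, j) * (xo - u) j) ^ 2
      < d * (1 - t) * ((xo - u).ofLp ⬝ᵥ (xo - u).ofLp)}
  have hEop : P.real (X ⁻¹' Eop) ≤ Real.exp (-((d : ℝ) / 2)) := by
    refine (hpull Eop).trans (ENNReal.toReal_le_of_le_ofReal (Real.exp_pos _).le ?_)
    have := measure_exists_unit_lt_bilinear_le (I := Fin d) (J := Fin n) (Real.sqrt_nonneg (d : ℝ))
    simp only [Fintype.card_fin, Real.sq_sqrt (Nat.cast_nonneg d)] at this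
    exact this
  have hElow : ∀ u, P.real (X ⁻¹' Elow u)
      ≤ Real.exp ((d : ℝ) / 2 * (t + Real.log (1 - t))) := fun u => by
    refine (hpull _).trans ?_
    have := measureReal_sum_mulVec_sq_lt_le (I := Fin d) (xo - u).ofLp ht0 ht1
    rw [Fintype.card_fin] at this
    exact this
  have hsub : {ω | 1 / √(1 - t) * (√((n : ℝ) / d) + 2) * ((2 : ℝ)⁻¹ ^ m * √n + 2 * ε)
      + (2 : ℝ)⁻¹ ^ m * √n < ‖xo - xhat ω‖} ⊆
      (⋃ u ∈ hfin.toFinset, X ⁻¹' Elow u) ∪ X ⁻¹' Eop := by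
    intro ω hω
    by_contra hcon
    simp only [Set.mem_union, Set.mem_iUnion, Set.Finite.mem_toFinset, not_or, not_exists] at hcon
    obtain ⟨hlow, hop⟩ := hcon
    refine absurd ?_ (not_le.2 (Set.mem_ofPred.1 hω))
    refine norm_sub_le_of_isLowComplexityLeastSquares hd ht1 hxD hclose hK (hxhat ω)
      (norm_toEuclideanLin_le (by positivity) fun v w hv hw => ?_) fun u hu => ?_
    · exact not_lt.1 fun h => hop ⟨v, w, hv, hw, h⟩
    · have h : d * (1 - t) * ((xo - u).ofLp ⬝ᵥ (xo - u).ofLp)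
          ≤ ∑ i, (∑ j, A ω i j * (xo - u) j) ^ 2 := not_lt.1 fun hlt => hlow u hu hlt
      have e1 : (xo - u).ofLp ⬝ᵥ (xo - u).ofLp = ‖xo - u‖ ^ 2 := by
        rw [EuclideanSpace.real_norm_sq_eq, dotProduct]
        exact Finset.sum_congr rfl fun i _ => (sq _).symm
      rw [e1] at h
      refine h.trans (le_of_eq ?_)
      rw [EuclideanSpace.real_norm_sq_eq]
      exact Finset.sum_congr rfl fun i _ => by rw [toEuclideanLin_apply_eq_sum]
  calc _ ≤ P.real ((⋃ u ∈ hfin.toFinset, X ⁻¹' Elow u) ∪ X ⁻¹' Eop) := measureReal_mono hsub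
    _ ≤ P.real (⋃ u ∈ hfin.toFinset, X ⁻¹' Elow u) + P.real (X ⁻¹' Eop) :=
        measureReal_union_le _ _
    _ ≤ (∑ u ∈ hfin.toFinset, P.real (X ⁻¹' Elow u)) + Real.exp (-((d : ℝ) / 2)) :=
        add_le_add (measureReal_biUnion_finset_le _ _) hEop
    _ ≤ _ := by
        refine add_le_add ?_ le_rfl
        refine (Finset.sum_le_card_nsmul _ _ _ fun u _ => hElow u).trans ?_
        rw [nsmul_eq_mul, ← Set.ncard_eq_toFinset_card _ hfin]
        exact mul_le_mul_of_nonneg_right hcard (Real.exp_pos _).le
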